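/- **Setting.** For functions $g$ of $n\in\mathbb Z$ put $(\Gamma g)(n)=g(n+1)$, $\Delta=\Gamma-1$, and compose pseudo-difference operators $\sum_{k\le N}a_k(n)\Delta^k$ by the rule $\Delta^j\circ g=\sum_{i\ge0}\binom ji(\Delta^i g)(n+j-i)\Delta^{j-i}$, $j\in\mathbb Z$. All functions depend on $n\in\mathbb Z$, on real times $t=(t_1,t_2,\dots)$ (finitely many nonzero) and on a real flow parameter $\alpha$; they are complex valued and smooth in every finite set of the variables $t_i,\alpha$. In $(\Gamma\psi)$ and $(\Delta\psi)$ below the functions act by multiplication. $A_{\ge1}$, $A_{\le0}$ are the parts of $A$ with powers $\Delta^k$, $k\ge1$, $k\le0$; $\operatorname{res}_\Delta A$ is the coefficient of $\Delta^{-1}$; $\Gamma^*=\Gamma^{-1}$, $\Delta^*=\Gamma^{-1}-1$. Let $Z=z_0+z_1\Delta^{-1}+z_2\Delta^{-2}+\cdots$ with $z_0$ nowhere zero, and $L=Z\Delta Z^{-1}$, be a solution (for every $\alpha$) of the discrete modified KP hierarchy $$\frac{\partial Z}{\partial t_i}=-(L^i)_{\le0}Z,\qquad i=1,2,\dots$$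 Let $\phi_1,\dots,\phi_m$ be eigenfunctions, $\partial_{t_i}\phi=(L^i)_{\ge1}(\phi)$, and $\psi_1,\dots,\psi_m$ adjoint eigenfunctions, $\partial_{t_i}\psi=-(\Delta^{-1}(L^i)_{\ge1}^*\Delta)(\psi)$, where $\Delta^{-1}\Delta^*$ means $-\Gamma^{-1}$. Let $S(\phi_j,\Delta\psi_j)$ be squared eigenfunction potentials, that is, $$\Delta S(\phi,\Delta\psi)=\phi\,(\Delta\psi),\qquad \partial_{t_i}S(\phi,\Delta\psi)=\operatorname{res}_\Delta\bigl(\Delta^{-1}(\Delta\psi)(L^i)_{\ge1}\phi\,\Delta^{-1}\bigr)\quad(i\ge1),$$ and put $\hat S(\Delta\phi,\Gamma\psi)=\phi\psi-S(\phi,\Delta\psi)$. Put $\xi(t,\lambda)=\sum_{i\ge1}t_i\lambda^i$ and $[z]=(z,z^2/2,z^3/3,\dots)$. A pair of tau functions of the solution is a pair of nowhere vanishing functions $\tau_0,\tau_1$ such that, as formal series in $\lambda^{-1}$ (with $f(t\pm[\lambda^{-1}])=\exp(\pm\sum_{l\ge1}\tfrac{1}{l}\lambda^{-l}\partial_{t_l})f$),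 $$Z(1+\lambda)^ne^{\xi(t,\lambda)}=\frac{\tau_0(n,t-[\lambda^{-1}])}{\tau_1(n,t)}(1+\lambda)^ne^{\xi(t,\lambda)},$$ $$(Z^{-1}(n-1)\Delta^{-1})^*(1+\lambda)^{-n}e^{-\xi(t,\lambda)}=\frac{\tau_1(n,t+[\lambda^{-1}])}{\tau_0(n,t)}\lambda^{-1}(1+\lambda)^{-n}e^{-\xi(t,\lambda)} .$$ Such a pair remains one when both functions are multiplied by the same smooth nonzero factor $\kappa(n,\alpha)$ that does not depend on $t$. **Theorem 4.1.** Suppose that $Z$ evolves by the squared eigenfunction symmetry flow $$\partial_\alpha Z=\sum_{j=1}^m\phi_j\Delta^{-1}(\Gamma\psi_j)\Delta\, Z .$$ Then $\partial_\alpha L=\bigl[\sum_{j=1}^m\phi_j\Delta^{-1}(\Gamma\psi_j)\Delta,\,L\bigr]$. For every pair of tau functions there is a function $c(n,\alpha)$, independent of $t$, such that $$\partial_\alpha\tau_0=\Bigl(\sum_{j=1}^mS(\phi_j,\Delta\psi_j)+c\Bigr)\tau_0,\qquad \partial_\alpha\tau_1=\Bigl(-\sum_{j=1}^m\hat S(\Delta\phi_j,\Gamma\psi_j)+c\Bigr)\tau_1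 ,$$ and after multiplication of $\tau_0$ and $\tau_1$ by one suitable common nonzero factor $\kappa(n,\alpha)$ independent of $t$ (which gives again a pair of tau functions) the flow is exactly $$\partial_\alpha\tau_0=\sum_{j=1}^mS(\phi_j,\Delta\psi_j)\,\tau_0,\qquad \partial_\alpha\tau_1=-\sum_{j=1}^m\hat S(\Delta\phi_j,\Gamma\psi_j)\,\tau_1 .$$ -/

import Mathlib

open scoped ContDiff

noncomputable section

namespace DMKP

/-! ### Pseudo-difference operators with coefficients depending on the lattice variable -/

/-- Formal pseudo-difference operators `∑_{k ≤ N} a_k(n) Δ^k`. An operator is stored as its family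
of coefficients: `A.1 k n` is the value at the lattice point `n` of the coefficient of `Δ^k`. -/
def opSubgroup : AddSubgroup (ℤ → ℤ → ℂ) where
  carrier := {a | ∃ N : ℤ, ∀ k, N < k → a k = 0}
  zero_mem' := ⟨0, fun _ _ => rfl⟩
  add_mem' := by
    rintro a b ⟨N, hN⟩ ⟨M, hM⟩
    refine ⟨max N M, fun k hk => ?_⟩
    simp [hN k (lt_of_le_of_lt (le_max_left _ _) hk), hM k (lt_of_le_of_lt (le_max_right _ _) hk)]
  neg_mem' := by
    rintro a ⟨N, hN⟩
    exact ⟨N, fun k hk => by simp [hN k hk]⟩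

/-- The additive group of pseudo-difference operators. -/
abbrev Op : Type := ↥opSubgroup

/-- The difference `(Δ g)(n) = g(n+1) - g(n)` of a function on the lattice. -/
abbrev diff : (ℤ → ℂ) → (ℤ → ℂ) := fwdDiff (1 : ℤ)

/-- The adjoint difference `(Δ^* g)(n) = ((Γ⁻¹ - 1) g)(n) = g(n-1) - g(n)`. -/
def adjDiff (g : ℤ → ℂ) : ℤ → ℂ := fun n => g (n - 1) - g n

/-- Coefficient of `Δ^l` in the product `(∑ a_j Δ^j) ∘ (∑ b_k Δ^k)`, from the Leibniz rule
`Δ^j ∘ g = ∑_{i ≥ 0} (j choose i) (Δ^i g)(n + j - i) Δ^(j - i)`, `j ∈ ℤ`.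
Only finitely many pairs `(j, i)` contribute. -/
def mulCoeff (a b : ℤ → ℤ → ℂ) (l n : ℤ) : ℂ :=
  ∑ᶠ x : ℤ × ℕ, a x.1 n * ((Ring.choose x.1 x.2 : ℤ) : ℂ) *
    diff^[x.2] (b (l - x.1 + x.2)) (n + x.1 - x.2)

theorem iterate_diff_zero (i : ℕ) : diff^[i] (0 : ℤ → ℂ) = 0 := by
  induction i with
  | zero => rfl
  | succ i ih =>
    rw [Function.iterate_succ_apply', ih]
    funext n
    simp [fwdDiff]

theorem mulCoeff_mem (A B : Op) : mulCoeff A.1 B.1 ∈ opSubgroup := by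
  obtain ⟨a, N, hN⟩ := A
  obtain ⟨b, M, hM⟩ := B
  refine ⟨N + M, fun l hl => funext fun n => ?_⟩
  refine (finsum_congr fun x => ?_).trans finsum_zero
  by_cases hx : N < x.1
  · simp [hN x.1 hx]
  · have h : b (l - x.1 + x.2) = 0 := hM _ (by omega)
    simp [h, iterate_diff_zero]

/-- Composition of pseudo-difference operators. -/
instance : Mul Op := ⟨fun A B => ⟨mulCoeff A.1 B.1, mulCoeff_mem A B⟩⟩

/-- The monomial `f Δ^k`. -/
def monomial (k : ℤ) (f : ℤ → ℂ) : Op :=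
  ⟨fun j => if j = k then f else 0, k, fun _ hj => if_neg hj.ne'⟩

/-- The operator of multiplication by the function `f`. -/
def fn (f : ℤ → ℂ) : Op := monomial 0 f

/-- The identity operator. -/
instance : One Op := ⟨fn 1⟩

/-- `Δ` as an operator. -/
def Dop : Op := monomial 1 1

/-- `Δ⁻¹` as an operator. -/
def Dinv : Op := monomial (-1) 1

/-- Powers `A^i`. -/
def pow (A : Op) : ℕ → Op
  | 0 => 1
  | i + 1 => pow A i * A

/-- `A_{≥ 1}`. -/
def geOne (A : Op) : Op :=
  ⟨fun k => if 1 ≤ k then A.1 k else 0, by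
    obtain ⟨a, N, hN⟩ := A
    exact ⟨N, fun k hk => by simp [hN k hk]⟩⟩

/-- `A_{≤ 0}`. -/
def leZero (A : Op) : Op :=
  ⟨fun k => if k ≤ 0 then A.1 k else 0, 0, fun _ hk => if_neg (not_le.mpr hk)⟩

/-- `res_Δ A`, the coefficient of `Δ⁻¹`. -/
def res (A : Op) : ℤ → ℂ := A.1 (-1)

/-- The action `B(f) = ∑_{k ≥ 0} b_k Δ^k f` of a difference operator `B = ∑_{k ≥ 0} b_k Δ^k`
(a finite sum) on a function. -/
def act (B : Op) (f : ℤ → ℂ) (n : ℤ) : ℂ :=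
  ∑ᶠ k : ℕ, B.1 k n * diff^[k] f n

/-- For a difference operator `B = ∑_{k ≥ 1} b_k Δ^k` the adjoint is `B^* = ∑ (Δ^*)^k ∘ b_k`.
Since `Δ⁻¹ Δ^* = -Γ⁻¹`, the operator `Δ⁻¹ B^*` is
`-∑_{k ≥ 0} Γ⁻¹ (Δ^*)^k ∘ b_{k+1}` (a finite sum); this is its action on a function `g`. -/
def invDiffAdjAct (B : Op) (g : ℤ → ℂ) (n : ℤ) : ℂ :=
  -∑ᶠ k : ℕ, adjDiff^[k] (fun m => B.1 (k + 1) m * g m) (n - 1)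

/-! ### Times, the flow parameter, and derivatives -/

/-- A point `(t, α)`: the times `t = (t₁, t₂, …)` (finitely many of them nonzero, as usual) and the
parameter `α` of the symmetry flow. -/
abbrev Param : Type := (ℕ+ →₀ ℝ) × ℝ

/-- Direction of `∂/∂t_i`. -/
def tDir (i : ℕ+) : Param := (Finsupp.single i 1, 0)

/-- Direction of `∂_α`. -/
def aDir : Param := (0, 1)

/-- Smoothness of a function of infinitely many variables: it is smooth in any finite number
of them, i.e. `C^∞` on every finite dimensional affine subspace. -/
def Smooth (f : Param → ℂ) : Prop :=
  ∀ (d : ℕ) (p : Param) (v : Fin d → Param),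
    ContDiff ℝ ∞ (fun s : Fin d → ℝ => f (p + ∑ j, s j • v j))

/-- The family `A` of operators is differentiable (coefficientwise) at `p` in the direction `v`,
with derivative the operator `A'`. -/
def HasOpDeriv (A : Param → Op) (A' : Op) (p v : Param) : Prop :=
  ∀ k n : ℤ, HasLineDerivAt ℝ (fun q => (A q).1 k n) (A'.1 k n) p v

/-- Formal shift of the times: `shiftCoeff ε f k` is the coefficient of `z^k` in
`f(t + ε[z]) = exp(ε ∑_{l ≥ 1} (z^l / l) ∂/∂t_l) f`, where `[z] = (z, z²/2, z³/3, …)`.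
The exponential `h(z)` is the solution of `z h'(z) = ε (∑_l z^l ∂/∂t_l) h(z)`, `h(0) = f`, i.e.
`(k+1) h_{k+1} = ε ∑_{l=0}^{k} ∂/∂t_{l+1} h_{k-l}`. -/
def shiftCoeff (ε : ℂ) (f : Param → ℂ) : ℕ → Param → ℂ
  | 0 => f
  | k + 1 => fun p => ε / ((k : ℂ) + 1) *
      ∑ l : Fin (k + 1), lineDeriv ℝ (shiftCoeff ε f (k - l)) p (tDir l.1.succPNat)
  termination_by k => k
  decreasing_by omega

/-! ### The hierarchy -/

/-- The Lax operator `L = Z Δ Z⁻¹` (`Zi` being the inverse of `Z`). -/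
def lax (Z Zi : Param → Op) (p : Param) : Op := Z p * Dop * Zi p

/-- `Z = z₀ + z₁ Δ⁻¹ + z₂ Δ⁻² + ⋯`, with inverse `Zi`, is a dressing operator of the discrete
modified KP hierarchy: `z₀` has no zeros, the coefficients are smooth, and Sato's equations
`∂Z/∂t_i = -(L^i)_{≤ 0} Z` hold for all `i ≥ 1`, with `L = Z Δ Z⁻¹`. -/
structure IsDressing (Z Zi : Param → Op) : Prop where
  order_le : ∀ p (k : ℤ), 0 < k → (Z p).1 k = 0
  lead_ne : ∀ p n, (Z p).1 0 n ≠ 0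
  smooth : ∀ k n, Smooth (fun p => (Z p).1 k n)
  mul_inv : ∀ p, Z p * Zi p = 1
  inv_mul : ∀ p, Zi p * Z p = 1
  sato : ∀ (i : ℕ+) p,
    HasOpDeriv Z (-(leZero (pow (lax Z Zi p) i) * Z p)) p (tDir i)

/-- Eigenfunctions: `∂φ/∂t_i = (L^i)_{≥ 1}(φ)`. -/
structure IsEigenfunction (L : Param → Op) (φ : Param → ℤ → ℂ) : Prop where
  smooth : ∀ n, Smooth (fun p => φ p n)
  flow : ∀ (i : ℕ+) p n,
    HasLineDerivAt ℝ (fun q => φ q n) (act (geOne (pow (L p) i)) (φ p) n) p (tDir i)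

/-- Adjoint eigenfunctions: `∂ψ/∂t_i = -(Δ⁻¹ (L^i)_{≥ 1}^* Δ)(ψ)`. -/
structure IsAdjointEigenfunction (L : Param → Op) (ψ : Param → ℤ → ℂ) : Prop where
  smooth : ∀ n, Smooth (fun p => ψ p n)
  flow : ∀ (i : ℕ+) p n,
    HasLineDerivAt ℝ (fun q => ψ q n)
      (-invDiffAdjAct (geOne (pow (L p) i)) (diff (ψ p)) n) p (tDir i)

/-- `S` is a squared eigenfunction potential `S(φ, Δψ)`:
`Δ S = φ (Δψ)` and `∂S/∂t_i = res_Δ (Δ⁻¹ (Δψ) (L^i)_{≥ 1} φ Δ⁻¹)`. -/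
structure IsPotential (L : Param → Op) (φ ψ S : Param → ℤ → ℂ) : Prop where
  smooth : ∀ n, Smooth (fun p => S p n)
  diff_eq : ∀ p n, diff (S p) n = φ p n * diff (ψ p) n
  flow : ∀ (i : ℕ+) p n,
    HasLineDerivAt ℝ (fun q => S q n)
      (res (Dinv * fn (diff (ψ p)) * geOne (pow (L p) i) * fn (φ p) * Dinv) n) p (tDir i)

/-- The second potential `Ŝ(Δφ, Γψ) = φ ψ - S(φ, Δψ)`. -/
def hatS (φ ψ S : Param → ℤ → ℂ) : Param → ℤ → ℂ := fun p n => φ p n * ψ p n - S p n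

/-- The coefficient of `λ^(-k)` in `w / ((1+λ)^n e^{ξ(t,λ)})`, where
`w = Z (1+λ)^n e^{ξ(t,λ)}` is the wave function. As `Δ^j (1+λ)^n = λ^j (1+λ)^n` for all `j`, this
is `z_k`. -/
def waveCoeff (Z : Param → Op) (k : ℕ) (n : ℤ) (p : Param) : ℂ := (Z p).1 (-k) n

/-- The coefficient of `λ^(-k)` in `w^* / (λ⁻¹ (1+λ)^(-n) e^{-ξ(t,λ)})`, where
`w^* = (Z⁻¹(n-1) Δ⁻¹)^* (1+λ)^(-n) e^{-ξ(t,λ)}` is the adjoint wave function.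
With `Z⁻¹ = ∑_{j ≥ 0} y_j Δ^(-j)` one has
`(Z⁻¹(n-1) Δ⁻¹)^* = ∑_j (Δ^*)^(-j-1) ∘ y_j(n-1)`, and, since
`(1+λ)^n ∘ Δ^* ∘ (1+λ)^(-n) = λ Γ⁻¹ (1 - λ⁻¹ Δ)`,
`(1+λ)^n (Δ^*)^(-j-1) (y (1+λ)^(-n)) =
  ∑_{r ≥ 0} (j+r choose r) λ^(-j-r-1) (Δ^r y)(n+j+1)`. -/
def adjWaveCoeff (Zi : Param → Op) (k : ℕ) (n : ℤ) (p : Param) : ℂ :=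
  ∑ r ∈ Finset.range (k + 1),
    (k.choose r : ℂ) * diff^[r] ((Zi p).1 ((r : ℤ) - k)) (n + (k - r))

/-- `(τ₀, τ₁)` is a pair of tau functions of the solution: `τ₀`, `τ₁` are smooth without zeros and
`w  = τ₀(n, t - [λ⁻¹]) / τ₁(n, t) (1+λ)^n e^{ξ(t,λ)}`,
`w^* = τ₁(n, t + [λ⁻¹]) / τ₀(n, t) λ⁻¹ (1+λ)^(-n) e^{-ξ(t,λ)}`
as formal series in `λ⁻¹`. -/
structure IsTauPair (Z Zi : Param → Op) (τ₀ τ₁ : ℤ → Param → ℂ) : Prop where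
  smooth₀ : ∀ n, Smooth (τ₀ n)
  smooth₁ : ∀ n, Smooth (τ₁ n)
  ne_zero₀ : ∀ n p, τ₀ n p ≠ 0
  ne_zero₁ : ∀ n p, τ₁ n p ≠ 0
  wave : ∀ k n p, waveCoeff Z k n p = shiftCoeff (-1) (τ₀ n) k p / τ₁ n p
  adjWave : ∀ k n p, adjWaveCoeff Zi k n p = shiftCoeff 1 (τ₁ n) k p / τ₀ n p

/-- The operator `∑_i φ_i Δ⁻¹ (Γψ_i) Δ`, where `(Γψ)(n) = ψ(n+1)`. -/
def symOp {m : ℕ} (φ ψ : Fin m → Param → ℤ → ℂ) (p : Param) : Op :=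
  ∑ i, fn (φ i p) * Dinv * fn (fun n => ψ i p (n + 1)) * Dop

/-- The squared eigenfunction symmetry flow on the dressing operator:
`∂_α Z = (∑_i φ_i Δ⁻¹ (Γψ_i) Δ) Z`. -/
def IsSymmetryFlow {m : ℕ} (Z : Param → Op) (φ ψ : Fin m → Param → ℤ → ℂ) : Prop :=
  ∀ p, HasOpDeriv Z (symOp φ ψ p * Z p) p aDir

end DMKP

end

/-! Write z = λ⁻¹ and let E = z d/dz + ∑_l z^l ∂/∂t_l act as a derivation on power series in z. A
series of the form f(t - [z]) is annihilated by E, and for a series constant in z, E f = 0 says that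
f does not depend on the times.

Let P = ∑_{l ≥ 1} z^l (L^l)_{≥ 1} and T = Z(t - [z]) (1 - zΔ) Z(t)⁻¹. Sato's equations become E T =
-T P (`IsSato.euler_transition`). Hence every coefficient of T after the constant term 1 has only
powers Δ^k with k ≥ 1, while T has order at most 1; so T = 1 + cΔ with a single series c. Therefore
T P = -(E c)Δ, and T kills the wave function w because 1 - zΔ kills (1+λ)^n.

Define H by Δ⁻¹(Γψ)Δ w = H w. Applying Δ and using w = -cΔw gives ΓH - cΔH = Γψ
(`IsSato.shiftPS_shiftedAdjoint`). This relation factors Δψ through T, so that Δ⁻¹(Δψ)P can be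
computed (`IsSato.pairing_posSeries`). From it follow E H = 0, that is H = ψ(t - [z]), and E S = φ
Eψ - (H - ψ) Eφ, whence E Ŝ = E(φH) (`euler_C_hatS`).

The flow multiplies w by ∑ φ_j H_j. Differentiating w τ₁ = τ₀(t - [z]) (exponential factor dropped)
in α shows that ∑ φ_j H_j + ∂_α log τ₁ is the logarithmic derivative of a series annihilated by E,
so E annihilates it too. Thus c(n,α) = ∑ Ŝ_j + ∂_α log τ₁ is independent of the times, which is the
equation for τ₁; the coefficient of z⁰ gives that for τ₀ (`exists_tau_flow`). The factor exp(-∫ c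
dα) removes c from both. -/

noncomputable section

namespace DMKP

/-! ### Coefficients of products of pseudo-difference operators -/

/-- `A` has no powers `Δ^k` with `k > N`. -/
def OrderLE (A : Op) (N : ℤ) : Prop := ∀ k, N < k → A.1 k = 0

theorem exists_orderLE (A : Op) : ∃ N, OrderLE A N := A.2

theorem OrderLE.mono {A : Op} {N M : ℤ} (h : OrderLE A N) (hNM : N ≤ M) : OrderLE A M :=
  fun k hk => h k (lt_of_le_of_lt hNM hk)

theorem op_ext {A B : Op} (h : ∀ k n, A.1 k n = B.1 k n) : A = B :=
  Subtype.ext (funext fun k => funext fun n => h k n)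

@[simp] theorem add_coeff (A B : Op) (k : ℤ) : (A + B).1 k = A.1 k + B.1 k := rfl
@[simp] theorem neg_coeff (A : Op) (k : ℤ) : (-A).1 k = -A.1 k := rfl
@[simp] theorem sub_coeff (A B : Op) (k : ℤ) : (A - B).1 k = A.1 k - B.1 k := rfl
@[simp] theorem zero_coeff (k : ℤ) : (0 : Op).1 k = 0 := rfl

theorem diff_apply (g : ℤ → ℂ) (n : ℤ) : diff g n = g (n + 1) - g n := rfl

theorem iterate_diff_add (i : ℕ) (f g : ℤ → ℂ) :
    diff^[i] (f + g) = diff^[i] f + diff^[i] g := fwdDiff_iter_add _ _ _ _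

/-- The coefficient of `Δ^l` in `Δ^j ∘ ∑ b_k Δ^k`. -/
def leftShift (j : ℤ) (b : ℤ → ℤ → ℂ) (l n : ℤ) : ℂ :=
  ∑ᶠ i : ℕ, ((Ring.choose j i : ℤ) : ℂ) * diff^[i] (b (l - j + i)) (n + j - i)

theorem leftShift_eq_sum {b : ℤ → ℤ → ℂ} {M : ℤ} (hb : ∀ k, M < k → b k = 0) (j l n : ℤ)
    {K : ℕ} (hK : M < l - j + K) :
    leftShift j b l n = ∑ i ∈ Finset.range K,
      ((Ring.choose j i : ℤ) : ℂ) * diff^[i] (b (l - j + i)) (n + j - i) := by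
  refine finsum_eq_sum_of_support_subset _ fun i hi => ?_
  by_contra hiK
  simp only [Finset.coe_range, Set.mem_Iio, not_lt] at hiK
  exact hi (by simp only [hb (l - j + i) (by omega), iterate_diff_zero]; simp)

theorem leftShift_eq_zero {b : ℤ → ℤ → ℂ} {M : ℤ} (hb : ∀ k, M < k → b k = 0) {j l : ℤ} (n : ℤ)
    (h : j < l - M) : leftShift j b l n = 0 := by
  rw [leftShift_eq_sum hb j l n (K := 0) (by push_cast; omega)]
  simp

/-- Terms with j < l - M vanish, so the lower end `J` may be any smaller bound; this freedom lets
several products be compared over one index range. -/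
theorem mul_coeff_eq_sum {A B : Op} {N M : ℤ} (hA : OrderLE A N) (hB : OrderLE B M) (l n : ℤ)
    {J : ℤ} (hJ : J ≤ l - M) :
    (A * B).1 l n = ∑ j ∈ Finset.Icc J N, A.1 j n * leftShift j B.1 l n := by
  have hs : (A * B).1 l n = ∑ x ∈ Finset.Icc J N ×ˢ Finset.range (N + M - l + 1).toNat,
      A.1 x.1 n * ((Ring.choose x.1 x.2 : ℤ) : ℂ) *
        diff^[x.2] (B.1 (l - x.1 + x.2)) (n + x.1 - x.2) := by
    refine finsum_eq_sum_of_support_subset _ fun x hx => ?_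
    have h1 : x.1 ≤ N := by
      by_contra h
      exact hx (by simp [hA x.1 (by omega)])
    have h2 : l - x.1 + x.2 ≤ M := by
      by_contra h
      exact hx (by simp [hB (l - x.1 + x.2) (by omega), iterate_diff_zero])
    simp only [Finset.coe_product, Set.mem_prod, Finset.mem_coe, Finset.mem_Icc, Finset.mem_range]
    omega
  rw [hs, Finset.sum_product]
  refine Finset.sum_congr rfl fun j hj => ?_
  rw [Finset.mem_Icc] at hj
  rw [leftShift_eq_sum hB j l n (K := (N + M - l + 1).toNat) (by omega), Finset.mul_sum]
  exact Finset.sum_congr rfl fun i _ => mul_assoc _ _ _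

theorem OrderLE.mul {A B : Op} {N M : ℤ} (hA : OrderLE A N) (hB : OrderLE B M) :
    OrderLE (A * B) (N + M) := by
  intro l hl
  funext n
  rw [mul_coeff_eq_sum hA hB l n le_rfl, Finset.Icc_eq_empty (by omega)]
  simp

theorem OrderLE.add {A B : Op} {N : ℤ} (hA : OrderLE A N) (hB : OrderLE B N) :
    OrderLE (A + B) N := fun k hk => by simp [hA k hk, hB k hk]

theorem OrderLE.neg {A : Op} {N : ℤ} (hA : OrderLE A N) : OrderLE (-A) N :=
  fun k hk => by simp [hA k hk]

theorem orderLE_monomial (k : ℤ) (f : ℤ → ℂ) : OrderLE (monomial k f) k :=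
  fun _ hj => if_neg hj.ne'

theorem monomial_coeff (k : ℤ) (f : ℤ → ℂ) (j n : ℤ) :
    (monomial k f).1 j n = if j = k then f n else 0 := by
  simp only [monomial]
  split_ifs <;> rfl

theorem monomial_mul_coeff (j : ℤ) (f : ℤ → ℂ) (B : Op) (l n : ℤ) :
    (monomial j f * B).1 l n = f n * leftShift j B.1 l n := by
  obtain ⟨M, hB⟩ := exists_orderLE B
  by_cases h : l - M ≤ j
  · rw [mul_coeff_eq_sum (orderLE_monomial j f) hB l n le_rfl, Finset.sum_eq_single j]
    · rw [monomial_coeff, if_pos rfl]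
    · intro i _ hi
      rw [monomial_coeff, if_neg hi, zero_mul]
    · intro hj
      exact absurd (Finset.mem_Icc.2 ⟨h, le_rfl⟩) hj
  · rw [mul_coeff_eq_sum (orderLE_monomial j f) hB l n le_rfl, Finset.Icc_eq_empty h,
      leftShift_eq_zero hB n (by omega)]
    simp

theorem leftShift_zero (b : ℤ → ℤ → ℂ) (l n : ℤ) : leftShift 0 b l n = b l n := by
  rw [leftShift, finsum_eq_single _ 0]
  · simp
  · intro i hi
    obtain ⟨k, rfl⟩ := Nat.exists_eq_succ_of_ne_zero hi
    simp

theorem fn_mul_coeff (f : ℤ → ℂ) (B : Op) (l n : ℤ) : (fn f * B).1 l n = f n * B.1 l n := by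
  rw [fn, monomial_mul_coeff, leftShift_zero]

theorem leftShift_one (b : ℤ → ℤ → ℂ) (l n : ℤ) :
    leftShift 1 b l n = b (l - 1) (n + 1) + diff (b l) n := by
  rw [leftShift, finsum_eq_sum_of_support_subset (s := Finset.range 2)]
  · simp [Finset.sum_range_succ]
  · intro i hi
    by_contra hi2
    simp only [Finset.coe_range, Set.mem_Iio, not_lt] at hi2
    refine hi ?_
    have : Ring.choose (1 : ℤ) i = 0 := by
      have := Ring.choose_natCast (R := ℤ) 1 i
      rw [Nat.choose_eq_zero_of_lt (by omega)] at this
      simpa using this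
    simp [this]

theorem Dop_mul_coeff (B : Op) (l n : ℤ) :
    (Dop * B).1 l n = B.1 (l - 1) (n + 1) + diff (B.1 l) n := by
  rw [Dop, monomial_mul_coeff, leftShift_one]
  simp

/-! ### Powers of Δ, associativity and the ring structure -/

theorem mul_monomial_one_coeff (A : Op) (k l n : ℤ) : (A * monomial k 1).1 l n = A.1 (l - k) n := by
  have hLS : ∀ j, leftShift j (monomial k 1).1 l n = if j = l - k then 1 else 0 := by
    intro j
    rw [leftShift, finsum_eq_single _ 0]
    · simp [monomial_coeff, eq_sub_iff_add_eq, add_comm, eq_comm]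
    · intro i hi
      obtain ⟨i, rfl⟩ := Nat.exists_eq_succ_of_ne_zero hi
      have : diff ((monomial k 1).1 (l - j + (i + 1 : ℕ))) = 0 := by
        funext n
        simp only [diff_apply, monomial_coeff]
        simp
      rw [Nat.succ_eq_add_one, Function.iterate_succ_apply, this, iterate_diff_zero]
      simp
  obtain ⟨N, hA⟩ := exists_orderLE A
  rw [mul_coeff_eq_sum hA (orderLE_monomial k 1) l n le_rfl]
  simp only [hLS, mul_ite, mul_one, mul_zero, Finset.sum_ite_eq', Finset.mem_Icc, le_refl, true_and]
  split_ifs with h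
  · rfl
  · rw [hA _ (by omega)]; rfl

/-- This is (Δ^(j+1) + Δ^j) ∘ c = Γ ∘ (Δ^j ∘ c) read off at Δ^l. It reduces to Pascal's rule, which
`Ring.choose` satisfies for negative j as well. -/
theorem leftShift_pascal {c : ℤ → ℤ → ℂ} {M : ℤ} (hc : ∀ k, M < k → c k = 0) (j l n : ℤ) :
    leftShift (j + 1) c l n + leftShift j c l n
      = leftShift j c (l - 1) (n + 1) + leftShift j c l (n + 1) := by
  obtain ⟨K, hK⟩ : ∃ K : ℕ, M < l - j + K := ⟨(M - l + j + 1).toNat, by omega⟩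
  rw [leftShift_eq_sum hc (j + 1) l n (K := K + 1) (by push_cast; omega),
    leftShift_eq_sum hc j (l - 1) (n + 1) (K := K + 1) (by push_cast; omega),
    leftShift_eq_sum hc j l n hK, leftShift_eq_sum hc j l (n + 1) hK,
    Finset.sum_range_succ', Finset.sum_range_succ']
  have e1 : ∀ i : ℕ, l - (j + 1) + ((i + 1 : ℕ) : ℤ) = l - j + i := fun i => by push_cast; ring
  have e2 : ∀ i : ℕ, l - 1 - j + ((i + 1 : ℕ) : ℤ) = l - j + i := fun i => by push_cast; ring
  have e3 : ∀ i : ℕ, n + (j + 1) - ((i + 1 : ℕ) : ℤ) = n + j - i := fun i => by push_cast; ring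
  have e4 : ∀ i : ℕ, n + 1 + j - ((i + 1 : ℕ) : ℤ) = n + j - i := fun i => by push_cast; ring
  have e5 : ∀ i : ℕ, n + 1 + j - (i : ℤ) = n + j - i + 1 := fun i => by ring
  simp only [e1, e2, e3, e4, e5, Ring.choose_succ_succ, Function.iterate_succ_apply', diff_apply]
  have e6 : l - (j + 1) + ((0 : ℕ) : ℤ) = l - 1 - j + ((0 : ℕ) : ℤ) := by ring
  have e7 : n + (j + 1) - ((0 : ℕ) : ℤ) = n + j - ((0 : ℕ) : ℤ) + 1 := by ring
  rw [e6, e7]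
  simp only [Ring.choose_zero_right]
  rw [add_right_comm, add_right_comm _ _ (∑ x ∈ Finset.range K, ((Ring.choose j x : ℤ) : ℂ) *
    diff^[x] (c (l - j + x)) (n + j - x + 1)), ← Finset.sum_add_distrib, ← Finset.sum_add_distrib]
  congr 1
  refine Finset.sum_congr rfl fun i _ => ?_
  push_cast
  ring

/-- The base case of associativity. Pascal's identity rewrites each term of the left side; what
remains is a translation of the summation index. -/
theorem Dop_mul_mul (B C : Op) : Dop * B * C = Dop * (B * C) := by
  refine op_ext fun l n => ?_
  obtain ⟨N, hB⟩ := exists_orderLE B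
  obtain ⟨M, hC⟩ := exists_orderLE C
  have hDB : OrderLE (Dop * B) (N + 1) := by
    rw [add_comm]; exact (orderLE_monomial 1 1).mul hB
  have hB' : OrderLE B (N + 1) := hB.mono (by omega)
  rw [Dop_mul_coeff, diff_apply, mul_coeff_eq_sum hDB hC l n (J := l - M) le_rfl,
    mul_coeff_eq_sum hB hC (l - 1) (n + 1) (J := l - M - 1) (by omega),
    mul_coeff_eq_sum hB' hC l (n + 1) (J := l - M) le_rfl,
    mul_coeff_eq_sum hB' hC l n (J := l - M) le_rfl]
  have hre : ∑ j ∈ Finset.Icc (l - M - 1) N, B.1 j (n + 1) * leftShift j C.1 (l - 1) (n + 1)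
      = ∑ j ∈ Finset.Icc (l - M) (N + 1),
        B.1 (j - 1) (n + 1) * leftShift (j - 1) C.1 (l - 1) (n + 1) := by
    refine Finset.sum_bij (fun j _ => j + 1) ?_ ?_ ?_ ?_
    · intro j hj; simp only [Finset.mem_Icc] at hj ⊢; omega
    · intro a _ b _ h; simpa using h
    · intro j hj
      refine ⟨j - 1, ?_, by ring⟩
      simp only [Finset.mem_Icc] at hj ⊢; omega
    · intro j _; simp
  -- Moving the window down by one is harmless: the new term j = l - M - 1 vanishes by the order of
  -- C and the lost term j = N + 1 by the order of B.
  have hre2 : ∑ j ∈ Finset.Icc (l - M) (N + 1), B.1 j (n + 1) *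
        (leftShift j C.1 l (n + 1) - leftShift j C.1 l n)
      = ∑ j ∈ Finset.Icc (l - M) (N + 1), B.1 (j - 1) (n + 1) *
        (leftShift (j - 1) C.1 l (n + 1) - leftShift (j - 1) C.1 l n) := by
    have hs : ∑ j ∈ Finset.Icc (l - M - 1) N, B.1 j (n + 1) *
        (leftShift j C.1 l (n + 1) - leftShift j C.1 l n)
        = ∑ j ∈ Finset.Icc (l - M) (N + 1), B.1 (j - 1) (n + 1) *
        (leftShift (j - 1) C.1 l (n + 1) - leftShift (j - 1) C.1 l n) := by
      refine Finset.sum_bij (fun j _ => j + 1) ?_ ?_ ?_ ?_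
      · intro j hj; simp only [Finset.mem_Icc] at hj ⊢; omega
      · intro a _ b _ h; simpa using h
      · intro j hj
        refine ⟨j - 1, ?_, by ring⟩
        simp only [Finset.mem_Icc] at hj ⊢; omega
      · intro j _; simp
    rw [← hs]
    have h1 : ∑ j ∈ Finset.Icc (l - M) (N + 1), B.1 j (n + 1) *
        (leftShift j C.1 l (n + 1) - leftShift j C.1 l n)
        = ∑ j ∈ Finset.Icc (l - M - 1) (N + 1), B.1 j (n + 1) *
        (leftShift j C.1 l (n + 1) - leftShift j C.1 l n) := by
      refine Finset.sum_subset (Finset.Icc_subset_Icc (by omega) le_rfl) fun j hj hj' => ?_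
      simp only [Finset.mem_Icc] at hj hj'
      rw [leftShift_eq_zero hC _ (by omega), leftShift_eq_zero hC _ (by omega)]
      simp
    rw [h1]
    symm
    refine Finset.sum_subset (Finset.Icc_subset_Icc le_rfl (by omega)) fun j hj hj' => ?_
    simp only [Finset.mem_Icc] at hj hj'
    rw [hB j (by omega)]
    simp
  rw [hre]
  have hgoal : ∀ j, (Dop * B).1 j n * leftShift j C.1 l n
      = B.1 (j - 1) (n + 1) * leftShift (j - 1) C.1 (l - 1) (n + 1)
        + B.1 (j - 1) (n + 1) *
          (leftShift (j - 1) C.1 l (n + 1) - leftShift (j - 1) C.1 l n)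
        + B.1 j (n + 1) * leftShift j C.1 l n - B.1 j n * leftShift j C.1 l n := by
    intro j
    have hp := leftShift_pascal hC (j - 1) l n
    rw [sub_add_cancel] at hp
    rw [Dop_mul_coeff, diff_apply]
    linear_combination B.1 (j - 1) (n + 1) * hp
  simp only [hgoal, Finset.sum_sub_distrib, Finset.sum_add_distrib]
  rw [← hre2]
  simp only [mul_sub, Finset.sum_sub_distrib]
  ring

/-- Associativity is not yet available for multiplying by Δ⁻¹. Instead, the coefficient of Δ^(k+1)
in ΔX is ΓX_k + ΔX_{k+1}, which determines X_k from the coefficients above it; descend from the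
common order bound. -/
theorem Dop_mul_injective {X Y : Op} (h : Dop * X = Dop * Y) : X = Y := by
  obtain ⟨N, hX⟩ := exists_orderLE X
  obtain ⟨M, hY⟩ := exists_orderLE Y
  have key : ∀ d : ℕ, ∀ k, max N M - d < k → X.1 k = Y.1 k := by
    intro d
    induction d with
    | zero =>
      intro k hk
      rw [hX k (by omega), hY k (by omega)]
    | succ d ih =>
      intro k hk
      have h1 := ih (k + 1) (by push_cast at hk; omega)
      funext n
      have h2 := congrFun (congrFun (congrArg Subtype.val h) (k + 1)) (n - 1)
      rw [Dop_mul_coeff, Dop_mul_coeff, h1] at h2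
      simpa using h2
  exact Subtype.ext (funext fun k => key (max N M - k + 1).toNat k (by omega))

theorem Dop_mul_monomial_one (j : ℤ) : Dop * monomial j 1 = monomial (j + 1) 1 := by
  refine op_ext fun l n => ?_
  rw [mul_monomial_one_coeff, Dop, monomial_coeff, monomial_coeff]
  simp [sub_eq_iff_eq_add, add_comm]

/-- Induction on j in both directions from 0: upwards by associativity with Δ, downwards by
cancelling Δ on the left. -/
theorem monomial_one_mul_mul (j : ℤ) (B C : Op) :
    monomial j 1 * B * C = monomial j 1 * (B * C) := by
  have hstep : ∀ (j : ℤ) (B : Op), Dop * (monomial j 1 * B) = monomial (j + 1) 1 * B :=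
    fun j B => by rw [← Dop_mul_mul, Dop_mul_monomial_one]
  induction j using Int.induction_on generalizing B C with
  | zero =>
    refine op_ext fun l n => ?_
    have h : ∀ X : Op, monomial 0 1 * X = X := fun X => op_ext fun l n => by
      rw [← fn, fn_mul_coeff]; simp
    rw [h, h]
  | succ j ih => rw [← hstep, Dop_mul_mul, ih, hstep]
  | pred j ih =>
    apply Dop_mul_injective
    have := ih B C
    rw [← sub_add_cancel (-(j : ℤ)) 1] at this
    rw [← hstep, ← hstep, Dop_mul_mul] at this
    exact this

/-- Coefficients of A only multiply from the left, so exchanging the two finite sums reduces the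
claim to A = Δ^j. -/
theorem op_mul_assoc (A B C : Op) : A * B * C = A * (B * C) := by
  refine op_ext fun l n => ?_
  obtain ⟨N, hA⟩ := exists_orderLE A
  obtain ⟨M, hB⟩ := exists_orderLE B
  obtain ⟨R, hC⟩ := exists_orderLE C
  rw [mul_coeff_eq_sum (hA.mul hB) hC l n (J := l - R) le_rfl,
    mul_coeff_eq_sum hA (hB.mul hC) l n (J := l - R - M) (by omega)]
  have hLS : ∀ (j k : ℤ) (X : Op), leftShift j X.1 k n = (monomial j 1 * X).1 k n :=
    fun j k X => by rw [monomial_mul_coeff]; simp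
  calc _ = ∑ k ∈ Finset.Icc (l - R) (N + M), ∑ j ∈ Finset.Icc (l - R - M) N,
        A.1 j n * (leftShift j B.1 k n * leftShift k C.1 l n) := by
        refine Finset.sum_congr rfl fun k hk => ?_
        rw [Finset.mem_Icc] at hk
        rw [mul_coeff_eq_sum hA hB k n (J := l - R - M) (by omega), Finset.sum_mul]
        exact Finset.sum_congr rfl fun j _ => mul_assoc _ _ _
    _ = _ := by
        rw [Finset.sum_comm]
        refine Finset.sum_congr rfl fun j hj => ?_
        rw [Finset.mem_Icc] at hj
        have ho : OrderLE (monomial j 1 * B) (N + M) :=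
          ((orderLE_monomial j 1).mul hB).mono (by omega)
        rw [← Finset.mul_sum, hLS, ← monomial_one_mul_mul,
          mul_coeff_eq_sum ho hC l n (J := l - R) le_rfl]
        congr 1
        exact Finset.sum_congr rfl fun k _ => by rw [hLS]

theorem op_add_mul (A B C : Op) : (A + B) * C = A * C + B * C := by
  refine op_ext fun l n => ?_
  obtain ⟨N, hA⟩ := exists_orderLE A
  obtain ⟨M, hB⟩ := exists_orderLE B
  obtain ⟨R, hC⟩ := exists_orderLE C
  have hA' := hA.mono (le_max_left N M)
  have hB' := hB.mono (le_max_right N M)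
  rw [add_coeff, Pi.add_apply, mul_coeff_eq_sum (hA'.add hB') hC l n le_rfl,
    mul_coeff_eq_sum hA' hC l n le_rfl, mul_coeff_eq_sum hB' hC l n le_rfl,
    ← Finset.sum_add_distrib]
  exact Finset.sum_congr rfl fun j _ => by rw [add_coeff, Pi.add_apply, add_mul]

theorem op_mul_add (A B C : Op) : A * (B + C) = A * B + A * C := by
  refine op_ext fun l n => ?_
  obtain ⟨N, hA⟩ := exists_orderLE A
  obtain ⟨M, hB⟩ := exists_orderLE B
  obtain ⟨R, hC⟩ := exists_orderLE C
  have hB' := hB.mono (le_max_left M R)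
  have hC' := hC.mono (le_max_right M R)
  rw [add_coeff, Pi.add_apply, mul_coeff_eq_sum hA (hB'.add hC') l n le_rfl,
    mul_coeff_eq_sum hA hB' l n le_rfl, mul_coeff_eq_sum hA hC' l n le_rfl,
    ← Finset.sum_add_distrib]
  refine Finset.sum_congr rfl fun j _ => ?_
  obtain ⟨K, hK⟩ : ∃ K : ℕ, max M R < l - j + K := ⟨(max M R - l + j + 1).toNat, by omega⟩
  rw [leftShift_eq_sum hB' _ _ _ hK, leftShift_eq_sum hC' _ _ _ hK,
    leftShift_eq_sum (hB'.add hC') _ _ _ hK, ← mul_add, ← Finset.sum_add_distrib]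
  congr 1
  refine Finset.sum_congr rfl fun i _ => ?_
  rw [add_coeff, iterate_diff_add, Pi.add_apply, mul_add]

theorem op_one_mul (A : Op) : 1 * A = A := op_ext fun l n => by
  change (fn 1 * A).1 l n = _
  rw [fn_mul_coeff]; simp

theorem op_mul_one (A : Op) : A * 1 = A := op_ext fun l n => by
  change (A * monomial 0 1).1 l n = _
  rw [mul_monomial_one_coeff]; simp

instance : Ring Op :=
  { (inferInstance : AddCommGroup Op), (inferInstance : Mul Op), (inferInstance : One Op) with
    left_distrib := op_mul_add
    right_distrib := op_add_mul
    zero_mul := fun A => by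
      have h := op_add_mul 0 0 A
      rw [add_zero] at h
      exact left_eq_add.mp h
    mul_zero := fun A => by
      have h := op_mul_add A 0 0
      rw [add_zero] at h
      exact left_eq_add.mp h
    mul_assoc := op_mul_assoc
    one_mul := op_one_mul
    mul_one := op_mul_one }

/-! ### The formulas of the hierarchy as coefficients of products -/

theorem pow_eq (A : Op) (i : ℕ) : pow A i = A ^ i := by
  induction i with
  | zero => rw [pow_zero]; rfl
  | succ i ih => rw [pow_succ, ← ih]; rfl

theorem Dop_mul_Dinv : Dop * Dinv = 1 := by
  rw [Dinv, Dop_mul_monomial_one]; rfl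

theorem Dinv_mul_Dop : Dinv * Dop = 1 := op_ext fun l n => by
  change (Dinv * monomial 1 1).1 l n = (monomial 0 1).1 l n
  rw [mul_monomial_one_coeff, Dinv, monomial_coeff, monomial_coeff]
  simp [sub_eq_iff_eq_add]

theorem mul_Dinv_coeff (A : Op) (l n : ℤ) : (A * Dinv).1 l n = A.1 (l + 1) n := by
  rw [Dinv, mul_monomial_one_coeff, sub_neg_eq_add]

theorem mul_Dop_coeff (A : Op) (l n : ℤ) : (A * Dop).1 l n = A.1 (l - 1) n := by
  rw [Dop, mul_monomial_one_coeff]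

theorem fn_coeff (f : ℤ → ℂ) (k n : ℤ) : (fn f).1 k n = if k = 0 then f n else 0 :=
  monomial_coeff 0 f k n

theorem fn_mul_fn (f g : ℤ → ℂ) : fn f * fn g = fn (f * g) := op_ext fun l n => by
  rw [fn_mul_coeff, fn_coeff, fn_coeff]
  split_ifs <;> simp

theorem fn_add (f g : ℤ → ℂ) : fn (f + g) = fn f + fn g := op_ext fun l n => by
  rw [add_coeff, Pi.add_apply, fn_coeff, fn_coeff, fn_coeff]
  split_ifs <;> simp

/-- Functions as operators of multiplication. -/
def fnHom : (ℤ → ℂ) →+* Op where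
  toFun := fn
  map_one' := rfl
  map_mul' f g := (fn_mul_fn f g).symm
  map_zero' := op_ext fun l n => by rw [fn_coeff]; simp
  map_add' := fn_add

theorem Dop_mul_fn (f : ℤ → ℂ) : Dop * fn f = fn (fun n => f (n + 1)) * Dop + fn (diff f) := by
  refine op_ext fun l n => ?_
  rw [add_coeff, Pi.add_apply, Dop_mul_coeff, fn_mul_coeff, fn_coeff, fn_coeff, Dop, monomial_coeff]
  congr 1
  · simp [sub_eq_zero]
  · rw [diff_apply, fn_coeff, fn_coeff, diff_apply]
    split_ifs <;> simp

/-- Against a function, only the Leibniz term i = j of Δ^j yields Δ⁰, and negative powers of Δ yield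
none. The eigenfunction equation thus becomes an identity in the ring. -/
theorem act_eq (B : Op) (f : ℤ → ℂ) (n : ℤ) : act B f n = (B * fn f).1 0 n := by
  obtain ⟨N, hB⟩ := exists_orderLE B
  have h0 : OrderLE (fn f) 0 := orderLE_monomial 0 f
  have hB' := hB.mono (le_max_left N 0)
  have hLS : ∀ j : ℕ, leftShift j (fn f).1 0 n = diff^[j] f n := by
    intro j
    rw [leftShift, finsum_eq_single _ j]
    · have : (fn f).1 (0 - (j : ℤ) + j) = f := by
        rw [zero_sub, neg_add_cancel]; rfl
      have h1 : Ring.choose (j : ℤ) j = 1 := by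
        rw [Ring.choose_natCast, Nat.choose_self]; rfl
      rw [this, h1]
      simp
    · intro i hi
      have : (fn f).1 (0 - (j : ℤ) + i) = 0 := if_neg (by omega)
      rw [this, iterate_diff_zero]
      simp
  rw [mul_coeff_eq_sum hB' h0 0 n le_rfl, act,
    finsum_eq_sum_of_support_subset (s := Finset.range ((max N 0).toNat + 1))]
  · refine Finset.sum_bij (fun (i : ℕ) _ => (i : ℤ)) ?_ ?_ ?_ ?_
    · intro i hi
      simp only [Finset.mem_range, Finset.mem_Icc] at hi ⊢
      omega
    · intro a _ b _ h
      exact_mod_cast h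
    · intro j hj
      refine ⟨j.toNat, ?_, ?_⟩ <;> simp only [Finset.mem_range, Finset.mem_Icc] at hj ⊢ <;> omega
    · intro i _
      rw [hLS]
  · intro i hi
    by_contra h
    simp only [Finset.coe_range, Set.mem_Iio, not_lt] at h
    exact hi (by simp [hB' i (by omega)])

theorem choose_neg_one (i : ℕ) : Ring.choose (-1 : ℤ) i = (-1) ^ i := by
  induction i with
  | zero => simp
  | succ i ih =>
    have h := Ring.choose_succ_succ (-1 : ℤ) i
    rw [neg_add_cancel, Ring.choose_zero_succ, ih] at h
    rw [pow_succ]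
    linarith

theorem iterate_adjDiff (k : ℕ) (g : ℤ → ℂ) (n : ℤ) :
    adjDiff^[k] g n = (-1) ^ k * diff^[k] g (n - k) := by
  induction k generalizing n with
  | zero => simp
  | succ k ih =>
    rw [Function.iterate_succ_apply', Function.iterate_succ_apply', adjDiff, ih, ih, diff_apply]
    have e1 : n - ((k + 1 : ℕ) : ℤ) + 1 = n - k := by push_cast; ring
    have e2 : n - ((k + 1 : ℕ) : ℤ) = n - 1 - k := by push_cast; ring
    rw [e1, e2]
    ring

/-- In the expansion of Δ⁻¹ the binomials are (-1)^k, and (Δ^*)^k = (-1)^k Γ^(-k) Δ^k, so the two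
sums agree term by term. -/
theorem invDiffAdjAct_eq (B : Op) (g : ℤ → ℂ) (n : ℤ) :
    -invDiffAdjAct B g n = (Dinv * (fn g * B)).1 0 n := by
  rw [invDiffAdjAct, neg_neg, Dinv, monomial_mul_coeff, leftShift, Pi.one_apply, one_mul]
  refine finsum_congr fun k => ?_
  rw [iterate_adjDiff, choose_neg_one]
  have e1 : (0 : ℤ) - -1 + k = k + 1 := by ring
  have e2 : n + -1 - (k : ℤ) = n - 1 - k := by ring
  have e3 : (fn g * B).1 (k + 1) = fun m => B.1 (k + 1) m * g m :=
    funext fun m => by rw [fn_mul_coeff, mul_comm]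
  rw [e1, e2, e3]
  push_cast
  rfl

theorem Dinv_mul_fn_coeff_neg_one (f : ℤ → ℂ) (n : ℤ) : (Dinv * fn f).1 (-1) n = f (n - 1) := by
  rw [Dinv, monomial_mul_coeff, leftShift, finsum_eq_single _ 0]
  · simp [fn_coeff, sub_eq_add_neg]
  · intro i hi
    have : (fn f).1 (-1 - -1 + (i : ℤ)) = 0 := if_neg (by omega)
    rw [this, iterate_diff_zero]
    simp

/-! ### Calculus of functions that are smooth in every finite set of variables -/

theorem hasLineDerivAt_add {f g : Param → ℂ} {f' g' : ℂ} {p v : Param}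
    (hf : HasLineDerivAt ℝ f f' p v) (hg : HasLineDerivAt ℝ g g' p v) :
    HasLineDerivAt ℝ (fun q => f q + g q) (f' + g') p v :=
  HasDerivAt.add hf hg

theorem hasLineDerivAt_sub {f g : Param → ℂ} {f' g' : ℂ} {p v : Param}
    (hf : HasLineDerivAt ℝ f f' p v) (hg : HasLineDerivAt ℝ g g' p v) :
    HasLineDerivAt ℝ (fun q => f q - g q) (f' - g') p v :=
  HasDerivAt.sub hf hg

theorem hasLineDerivAt_mul {f g : Param → ℂ} {f' g' : ℂ} {p v : Param}
    (hf : HasLineDerivAt ℝ f f' p v) (hg : HasLineDerivAt ℝ g g' p v) :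
    HasLineDerivAt ℝ (fun q => f q * g q) (f' * g p + f p * g') p v := by
  have h := HasDerivAt.mul hf hg
  simp only [zero_smul, add_zero] at h
  exact h

theorem hasLineDerivAt_sum {ι : Type*} {s : Finset ι} {f : ι → Param → ℂ} {f' : ι → ℂ}
    {p v : Param} (hf : ∀ i ∈ s, HasLineDerivAt ℝ (f i) (f' i) p v) :
    HasLineDerivAt ℝ (fun q => ∑ i ∈ s, f i q) (∑ i ∈ s, f' i) p v :=
  HasDerivAt.fun_sum hf

theorem hasLineDerivAt_const (c : ℂ) (p v : Param) :
    HasLineDerivAt ℝ (fun _ => c) 0 p v :=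
  hasDerivAt_const _ _

theorem hasLineDerivAt_const_mul {f : Param → ℂ} {f' : ℂ} {p v : Param} (c : ℂ)
    (hf : HasLineDerivAt ℝ f f' p v) : HasLineDerivAt ℝ (fun q => c * f q) (c * f') p v :=
  HasDerivAt.const_mul c hf

theorem smooth_const (c : ℂ) : Smooth fun _ => c := fun _ _ _ => contDiff_const

theorem Smooth.add {f g : Param → ℂ} (hf : Smooth f) (hg : Smooth g) :
    Smooth fun p => f p + g p := fun d p v => (hf d p v).add (hg d p v)

theorem Smooth.sub {f g : Param → ℂ} (hf : Smooth f) (hg : Smooth g) :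
    Smooth fun p => f p - g p := fun d p v => (hf d p v).sub (hg d p v)

theorem Smooth.neg {f : Param → ℂ} (hf : Smooth f) : Smooth fun p => -f p :=
  fun d p v => (hf d p v).neg

theorem Smooth.mul {f g : Param → ℂ} (hf : Smooth f) (hg : Smooth g) :
    Smooth fun p => f p * g p := fun d p v => (hf d p v).mul (hg d p v)

theorem Smooth.sum {ι : Type*} {s : Finset ι} {f : ι → Param → ℂ} (hf : ∀ i ∈ s, Smooth (f i)) :
    Smooth fun p => ∑ i ∈ s, f i p := fun d p v => ContDiff.sum fun i hi => hf i hi d p v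

theorem Smooth.inv {f : Param → ℂ} (hf : Smooth f) (h0 : ∀ p, f p ≠ 0) :
    Smooth fun p => (f p)⁻¹ := fun d p v => (hf d p v).inv fun _ => h0 _

theorem smooth_comp_snd {κ : ℝ → ℂ} (hκ : ContDiff ℝ ∞ κ) : Smooth fun p => κ p.2 := by
  intro d p v
  refine hκ.comp ?_
  simp only [Prod.snd_add, Prod.snd_sum, Prod.smul_snd]
  fun_prop

theorem Smooth.contDiff_line {f : Param → ℂ} (hf : Smooth f) (p v : Param) :
    ContDiff ℝ ∞ fun t : ℝ => f (p + t • v) := by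
  have h := (hf 1 p fun _ => v).comp (g := fun s : Fin 1 → ℝ => f (p + ∑ j, s j • v))
    (f := fun t : ℝ => fun _ : Fin 1 => t) (by fun_prop)
  simpa [Function.comp_def] using h

theorem Smooth.hasLineDerivAt {f : Param → ℂ} (hf : Smooth f) (p v : Param) :
    HasLineDerivAt ℝ f (lineDeriv ℝ f p v) p v :=
  LineDifferentiableAt.hasLineDerivAt ((hf.contDiff_line p v).differentiable (by simp) 0)

/-- Passing to the restriction to a finite dimensional affine subspace makes Fréchet calculus
available. -/
theorem Smooth.lineDeriv_eq_fderiv {f : Param → ℂ} (hf : Smooth f) {d : ℕ} (p : Param)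
    (v : Fin d → Param) (s : Fin d → ℝ) (j : Fin d) :
    lineDeriv ℝ f (p + ∑ k, s k • v k) (v j)
      = fderiv ℝ (fun s : Fin d → ℝ => f (p + ∑ k, s k • v k)) s (Pi.single j 1) := by
  rw [← DifferentiableAt.lineDeriv_eq_fderiv ((hf d p v).differentiable (by simp) s)]
  unfold lineDeriv
  congr 1
  funext t
  have h : ∑ k, (s + t • (Pi.single j 1 : Fin d → ℝ)) k • v k = ∑ k, s k • v k + t • v j := by
    have h1 : ∀ k, (s + t • (Pi.single j 1 : Fin d → ℝ)) k • v k
        = s k • v k + (t * (Pi.single j 1 : Fin d → ℝ) k) • v k := fun k => add_smul _ _ (v k)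
    simp only [h1, Finset.sum_add_distrib]
    congr 1
    rw [Finset.sum_eq_single j]
    · simp
    · intro k _ hk
      simp [Pi.single_eq_of_ne hk]
    · simp
  simp only [h, add_assoc]

theorem Smooth.lineDeriv {f : Param → ℂ} (hf : Smooth f) (v : Param) :
    Smooth fun p => lineDeriv ℝ f p v := by
  intro d p w
  -- The direction `v` is adjoined as an extra coordinate, kept at the value 0, so that the
  -- derivative is taken along a coordinate axis.
  have h : (fun s : Fin d → ℝ => _root_.lineDeriv ℝ f (p + ∑ j, s j • w j) v)
      = fun s : Fin d → ℝ => fderiv ℝ (fun s : Fin (d + 1) → ℝ =>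
        f (p + ∑ k, s k • (Fin.cons v w : Fin (d + 1) → Param) k))
        (Fin.cons 0 s : Fin (d + 1) → ℝ) (Pi.single 0 1) := by
    funext s
    rw [← hf.lineDeriv_eq_fderiv p (Fin.cons v w : Fin (d + 1) → Param)]
    simp [Fin.sum_univ_succ]
  rw [h]
  have h1 : ContDiff ℝ ∞ (fderiv ℝ (fun s : Fin (d + 1) → ℝ =>
        f (p + ∑ k, s k • (Fin.cons v w : Fin (d + 1) → Param) k))) :=
    (hf (d + 1) p _).fderiv_right (by simp)
  refine ContDiff.clm_apply (h1.comp ?_) contDiff_const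
  rw [contDiff_pi]
  intro i
  refine Fin.cases ?_ (fun i => ?_) i
  · simpa using contDiff_const
  · simpa using contDiff_apply ℝ ℝ i

/-- Restricted to the affine subspace through `p` parametrized by `v` and `w`, this is the symmetry
of the second derivative. -/
theorem Smooth.lineDeriv_comm {f : Param → ℂ} (hf : Smooth f) (p v w : Param) :
    _root_.lineDeriv ℝ (fun q => _root_.lineDeriv ℝ f q v) p w
      = _root_.lineDeriv ℝ (fun q => _root_.lineDeriv ℝ f q w) p v := by
  set u : Fin 2 → Param := ![v, w] with hu
  set F : (Fin 2 → ℝ) → ℂ := fun s => f (p + ∑ k, s k • u k) with hF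
  have hFs : ContDiff ℝ ∞ F := hf 2 p u
  have hF1 : ContDiff ℝ ∞ (fderiv ℝ F) := hFs.fderiv_right (by simp)
  have key : ∀ i j : Fin 2, _root_.lineDeriv ℝ (fun q => _root_.lineDeriv ℝ f q (u i)) p (u j)
      = fderiv ℝ (fderiv ℝ F) 0 (Pi.single j 1) (Pi.single i 1) := by
    intro i j
    have h1 := (hf.lineDeriv (u i)).lineDeriv_eq_fderiv p u 0 j
    simp only [Pi.zero_apply, zero_smul, Finset.sum_const_zero, add_zero] at h1
    rw [h1]
    have h2 : (fun s : Fin 2 → ℝ => _root_.lineDeriv ℝ f (p + ∑ k, s k • u k) (u i))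
        = fun s => fderiv ℝ F s (Pi.single i 1) :=
      funext fun s => hf.lineDeriv_eq_fderiv p u s i
    rw [h2, fderiv_clm_apply (hF1.differentiable (by simp) 0) (differentiableAt_const _)]
    simp
  have hsymm : IsSymmSndFDerivAt ℝ F 0 :=
    (hFs.contDiffAt).isSymmSndFDerivAt (by
      simp only [minSmoothness_of_isRCLikeNormedField]
      exact WithTop.coe_le_coe.2 (le_top : (2 : ℕ∞) ≤ ⊤))
  have h01 := key 0 1
  have h10 := key 1 0
  simp only [hu, Matrix.cons_val_zero, Matrix.cons_val_one] at h01 h10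
  rw [h01, h10]
  exact hsymm _ _

/-- A smooth function all of whose time derivatives vanish does not depend on the times. -/
theorem Smooth.eq_of_lineDeriv_tDir_eq_zero {f : Param → ℂ} (hf : Smooth f)
    (h : ∀ i p, _root_.lineDeriv ℝ f p (tDir i) = 0) (t : ℕ+ →₀ ℝ) (a : ℝ) :
    f (t, a) = f (0, a) := by
  have hline : ∀ (i : ℕ+) (p : Param) (r : ℝ), f (p + r • tDir i) = f p := by
    intro i p r
    have hd : ∀ s, HasDerivAt (fun s : ℝ => f (p + s • tDir i)) 0 s := by
      intro s
      have h1 : HasDerivAt (fun u : ℝ => f (p + s • tDir i + u • tDir i)) 0 0 := by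
        have := hf.hasLineDerivAt (p + s • tDir i) (tDir i)
        rwa [h] at this
      have h2 := HasDerivAt.comp_sub_const (x := s) (a := s)
        (f := fun u : ℝ => f (p + s • tDir i + u • tDir i)) (f' := 0) (by rwa [sub_self])
      refine h2.congr_of_eventuallyEq (Filter.Eventually.of_forall fun u => ?_)
      simp only
      congr 1
      rw [add_assoc, ← add_smul s (u - s) (tDir i), add_sub_cancel]
    have := is_const_of_deriv_eq_zero (fun s => (hd s).differentiableAt)
      (fun s => (hd s).deriv) r 0
    simpa using this
  -- Only finitely many times are nonzero, so they can be brought to 0 one coordinate at a time.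
  induction t using Finsupp.induction with
  | zero => rfl
  | single_add i r t _ _ ih =>
    have := hline i (t, a) r
    rw [← ih, ← this]
    congr 1
    ext1
    · simp [tDir, add_comm]
    · simp [tDir]

theorem smooth_iterate_diff {g : Param → ℤ → ℂ} (hg : ∀ n, Smooth fun p => g p n) (i : ℕ) (n : ℤ) :
    Smooth fun p => diff^[i] (g p) n := by
  induction i generalizing n with
  | zero => exact hg n
  | succ i ih =>
    simp only [Function.iterate_succ_apply', diff_apply]
    exact (ih (n + 1)).sub (ih n)

theorem hasLineDerivAt_iterate_diff {g : Param → ℤ → ℂ} {g' : ℤ → ℂ} {p v : Param}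
    (hg : ∀ n, HasLineDerivAt ℝ (fun q => g q n) (g' n) p v) (i : ℕ) (n : ℤ) :
    HasLineDerivAt ℝ (fun q => diff^[i] (g q) n) (diff^[i] g' n) p v := by
  induction i generalizing n with
  | zero => exact hg n
  | succ i ih =>
    simp only [Function.iterate_succ_apply', diff_apply]
    exact hasLineDerivAt_sub (ih (n + 1)) (ih n)

/-- Order bounds uniform in the point turn each coefficient of the product into one finite
expression with fixed index ranges; the product rule below rests on the same formula. -/
theorem smooth_mul_coeff {A B : Param → Op} {N M : ℤ} (hA : ∀ p, OrderLE (A p) N)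
    (hB : ∀ p, OrderLE (B p) M) (hAs : ∀ k n, Smooth fun p => (A p).1 k n)
    (hBs : ∀ k n, Smooth fun p => (B p).1 k n) (l n : ℤ) :
    Smooth fun p => (A p * B p).1 l n := by
  have h : (fun p => (A p * B p).1 l n) = fun p => ∑ j ∈ Finset.Icc (l - M) N, (A p).1 j n *
      ∑ i ∈ Finset.range (M - l + j + 1).toNat, ((Ring.choose j i : ℤ) : ℂ) *
        diff^[i] ((B p).1 (l - j + i)) (n + j - i) := by
    funext p
    rw [mul_coeff_eq_sum (hA p) (hB p) l n le_rfl]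
    refine Finset.sum_congr rfl fun j _ => ?_
    rw [leftShift_eq_sum (hB p) j l n (K := (M - l + j + 1).toNat) (by omega)]
  rw [h]
  exact Smooth.sum fun j _ => (hAs j n).mul
    (Smooth.sum fun i _ => (smooth_const _).mul (smooth_iterate_diff (hBs _) i _))

theorem HasOpDeriv.mul {A B : Param → Op} {A' B' : Op} {p v : Param} {N M : ℤ}
    (hA : ∀ p, OrderLE (A p) N) (hB : ∀ p, OrderLE (B p) M) (hA' : OrderLE A' N)
    (hB' : OrderLE B' M) (hAd : HasOpDeriv A A' p v) (hBd : HasOpDeriv B B' p v) :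
    HasOpDeriv (fun q => A q * B q) (A' * B p + A p * B') p v := by
  intro l n
  have h : (fun q => (A q * B q).1 l n) = fun q => ∑ j ∈ Finset.Icc (l - M) N, (A q).1 j n *
      ∑ i ∈ Finset.range (M - l + j + 1).toNat, ((Ring.choose j i : ℤ) : ℂ) *
        diff^[i] ((B q).1 (l - j + i)) (n + j - i) := by
    funext p
    rw [mul_coeff_eq_sum (hA p) (hB p) l n le_rfl]
    refine Finset.sum_congr rfl fun j _ => ?_
    rw [leftShift_eq_sum (hB p) j l n (K := (M - l + j + 1).toNat) (by omega)]
  rw [h, add_coeff, Pi.add_apply, mul_coeff_eq_sum hA' (hB p) l n le_rfl,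
    mul_coeff_eq_sum (hA p) hB' l n le_rfl, ← Finset.sum_add_distrib]
  refine hasLineDerivAt_sum fun j _ => ?_
  have hK : M < l - j + (M - l + j + 1).toNat := by omega
  rw [leftShift_eq_sum (hB p) j l n hK, leftShift_eq_sum hB' j l n hK]
  exact hasLineDerivAt_mul (hAd j n) (hasLineDerivAt_sum fun i _ =>
    hasLineDerivAt_const_mul _ (hasLineDerivAt_iterate_diff (hBd _) i _))

/-! ### The rings of smooth functions and of smooth families of operators -/

/-- Smooth functions of `(p, n)`. -/
def smoothFn : Subring (Param → ℤ → ℂ) where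
  carrier := {f | ∀ n, Smooth fun p => f p n}
  mul_mem' := fun ha hb n => (ha n).mul (hb n)
  one_mem' := fun _ => smooth_const 1
  add_mem' := fun ha hb n => (ha n).add (hb n)
  zero_mem' := fun _ => smooth_const 0
  neg_mem' := fun ha n => (ha n).neg

/-- The ring of smooth functions. -/
abbrev Fn : Type := ↥smoothFn

theorem fn_ext {f g : Fn} (h : ∀ p n, f.1 p n = g.1 p n) : f = g :=
  Subtype.ext (funext fun p => funext fun n => h p n)

/-- Smooth families of operators of bounded order. -/
def smoothOp : Subring (Param → Op) where
  carrier := {A | (∃ N, ∀ p, OrderLE (A p) N) ∧ ∀ k n, Smooth fun p => (A p).1 k n}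
  mul_mem' := by
    rintro A B ⟨⟨N, hA⟩, hAs⟩ ⟨⟨M, hB⟩, hBs⟩
    exact ⟨⟨N + M, fun p => (hA p).mul (hB p)⟩, smooth_mul_coeff hA hB hAs hBs⟩
  one_mem' := ⟨⟨0, fun _ => orderLE_monomial 0 1⟩, fun _ _ => smooth_const _⟩
  add_mem' := by
    rintro A B ⟨⟨N, hA⟩, hAs⟩ ⟨⟨M, hB⟩, hBs⟩
    exact ⟨⟨max N M, fun p => ((hA p).mono (le_max_left _ _)).add ((hB p).mono (le_max_right _ _))⟩,
      fun k n => (hAs k n).add (hBs k n)⟩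
  zero_mem' := ⟨⟨0, fun _ _ _ => rfl⟩, fun _ _ => smooth_const 0⟩
  neg_mem' := by
    rintro A ⟨⟨N, hA⟩, hAs⟩
    exact ⟨⟨N, fun p => (hA p).neg⟩, fun k n => (hAs k n).neg⟩

/-- The ring of smooth families of operators. -/
abbrev OpFam : Type := ↥smoothOp

/-- The coefficient of `Δ^k`. -/
def co (k : ℤ) : OpFam →+ Fn where
  toFun A := ⟨fun p n => (A.1 p).1 k n, fun n => A.2.2 k n⟩
  map_zero' := rfl
  map_add' _ _ := rfl

theorem co_apply (k : ℤ) (A : OpFam) (p : Param) (n : ℤ) : (co k A).1 p n = (A.1 p).1 k n := rfl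

theorem opFam_ext {A B : OpFam} (h : ∀ k, co k A = co k B) : A = B :=
  Subtype.ext <| funext fun p => op_ext fun k n => by
    rw [← co_apply, h k, co_apply]

/-- Directional derivative of smooth functions. -/
def derivFn (v : Param) : Fn →+ Fn where
  toFun f := ⟨fun p n => lineDeriv ℝ (fun q => f.1 q n) p v, fun n => (f.2 n).lineDeriv v⟩
  map_zero' := fn_ext fun p _ => (hasLineDerivAt_const 0 p v).lineDeriv
  map_add' f g := fn_ext fun p n =>
    (hasLineDerivAt_add ((f.2 n).hasLineDerivAt p v) ((g.2 n).hasLineDerivAt p v)).lineDeriv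

theorem hasLineDerivAt_derivFn (v : Param) (f : Fn) (p : Param) (n : ℤ) :
    HasLineDerivAt ℝ (fun q => f.1 q n) ((derivFn v f).1 p n) p v :=
  (f.2 n).hasLineDerivAt p v

theorem derivFn_eq {v : Param} {f g : Fn}
    (h : ∀ p n, HasLineDerivAt ℝ (fun q => f.1 q n) (g.1 p n) p v) : derivFn v f = g :=
  fn_ext fun p n => (h p n).lineDeriv

theorem derivFn_mul (v : Param) (f g : Fn) :
    derivFn v (f * g) = derivFn v f * g + f * derivFn v g :=
  derivFn_eq fun p n =>
    hasLineDerivAt_mul (hasLineDerivAt_derivFn v f p n) (hasLineDerivAt_derivFn v g p n)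

theorem derivFn_one (v : Param) : derivFn v 1 = 0 :=
  derivFn_eq fun p _ => hasLineDerivAt_const 1 p v

theorem derivFn_comm (v w : Param) (f : Fn) :
    derivFn v (derivFn w f) = derivFn w (derivFn v f) :=
  fn_ext fun p n => (f.2 n).lineDeriv_comm p w v

/-- Directional derivative of smooth families of operators. -/
def derivOp (v : Param) : OpFam →+ OpFam where
  toFun A := ⟨fun p => ⟨fun k n => lineDeriv ℝ (fun q => (A.1 q).1 k n) p v, by
      obtain ⟨N, hN⟩ := A.2.1
      refine ⟨N, fun k hk => funext fun n => ?_⟩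
      have : (fun q => (A.1 q).1 k n) = fun _ => 0 := funext fun q => by rw [hN q k hk]; rfl
      simp only [this]
      exact (hasLineDerivAt_const 0 p v).lineDeriv⟩, by
    obtain ⟨N, hN⟩ := A.2.1
    refine ⟨⟨N, fun p k hk => funext fun n => ?_⟩, fun k n => (A.2.2 k n).lineDeriv v⟩
    have : (fun q => (A.1 q).1 k n) = fun _ => 0 := funext fun q => by rw [hN q k hk]; rfl
    simp only [this]
    exact (hasLineDerivAt_const 0 p v).lineDeriv⟩
  map_zero' := opFam_ext fun k => map_zero (derivFn v)
  map_add' A B := opFam_ext fun k => map_add (derivFn v) (co k A) (co k B)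

theorem co_derivOp (v : Param) (k : ℤ) (A : OpFam) : co k (derivOp v A) = derivFn v (co k A) := rfl

theorem hasOpDeriv_derivOp (v : Param) (A : OpFam) (p : Param) :
    HasOpDeriv A.1 ((derivOp v A).1 p) p v :=
  fun k n => hasLineDerivAt_derivFn v (co k A) p n

theorem derivOp_eq {v : Param} {A B : OpFam} (h : ∀ p, HasOpDeriv A.1 (B.1 p) p v) :
    derivOp v A = B :=
  opFam_ext fun k => (co_derivOp v k A).trans (derivFn_eq fun p n => h p k n)

theorem orderLE_derivOp {A : OpFam} {N : ℤ} (hA : ∀ p, OrderLE (A.1 p) N) (v p : Param) :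
    OrderLE ((derivOp v A).1 p) N := by
  intro k hk
  have : co k A = 0 := fn_ext fun p n => by rw [co_apply, hA p k hk]; rfl
  funext n
  rw [← co_apply, co_derivOp, this, map_zero]
  rfl

theorem derivOp_mul (v : Param) (A B : OpFam) :
    derivOp v (A * B) = derivOp v A * B + A * derivOp v B := by
  obtain ⟨N, hA⟩ := A.2.1
  obtain ⟨M, hB⟩ := B.2.1
  exact derivOp_eq fun p => HasOpDeriv.mul hA hB (orderLE_derivOp hA v p) (orderLE_derivOp hB v p)
    (hasOpDeriv_derivOp v A p) (hasOpDeriv_derivOp v B p)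

theorem derivOp_const (v : Param) (A : Op) (h) : derivOp v ⟨fun _ => A, h⟩ = 0 :=
  derivOp_eq fun p k n => hasLineDerivAt_const (A.1 k n) p v

theorem const_mem_smoothOp (A : Op) : (fun _ => A) ∈ smoothOp :=
  ⟨⟨(exists_orderLE A).choose, fun _ => (exists_orderLE A).choose_spec⟩, fun _ _ => smooth_const _⟩

/-- The constant family `Δ`. -/
def DFam : OpFam := ⟨fun _ => Dop, const_mem_smoothOp _⟩

/-- The constant family `Δ⁻¹`. -/
def DinvFam : OpFam := ⟨fun _ => Dinv, const_mem_smoothOp _⟩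

theorem DFam_mul_DinvFam : DFam * DinvFam = 1 := Subtype.ext (funext fun _ => Dop_mul_Dinv)

theorem DinvFam_mul_DFam : DinvFam * DFam = 1 := Subtype.ext (funext fun _ => Dinv_mul_Dop)

theorem derivOp_DFam (v : Param) : derivOp v DFam = 0 := derivOp_const v _ _

/-- Multiplication operators as a homomorphism. -/
def fnFam : Fn →+* OpFam where
  toFun f := ⟨fun p => fn (f.1 p), ⟨0, fun _ => orderLE_monomial 0 _⟩, fun k n => by
    simp only [fn_coeff]
    split_ifs
    · exact f.2 n
    · exact smooth_const 0⟩
  map_one' := rfl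
  map_mul' f g := Subtype.ext (funext fun p => map_mul fnHom (f.1 p) (g.1 p))
  map_zero' := Subtype.ext (funext fun p => map_zero fnHom)
  map_add' f g := Subtype.ext (funext fun p => fn_add (f.1 p) (g.1 p))

theorem fnFam_apply (f : Fn) (p : Param) : (fnFam f).1 p = fn (f.1 p) := rfl

theorem co_fnFam (k : ℤ) (f : Fn) : co k (fnFam f) = if k = 0 then f else 0 :=
  fn_ext fun p n => by
    rw [co_apply, fnFam_apply, fn_coeff]
    split_ifs <;> rfl

theorem derivOp_fnFam (v : Param) (f : Fn) : derivOp v (fnFam f) = fnFam (derivFn v f) :=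
  opFam_ext fun k => by
    rw [co_derivOp, co_fnFam, co_fnFam]
    split_ifs
    · rfl
    · exact map_zero _

/-- The shift `(Γ f)(n) = f(n+1)`. -/
def shiftFn : Fn ≃+* Fn where
  toFun f := ⟨fun p n => f.1 p (n + 1), fun n => f.2 (n + 1)⟩
  invFun f := ⟨fun p n => f.1 p (n - 1), fun n => f.2 (n - 1)⟩
  left_inv f := fn_ext fun p n => congrArg (f.1 p) (sub_add_cancel n 1)
  right_inv f := fn_ext fun p n => congrArg (f.1 p) (add_sub_cancel_right n 1)
  map_mul' _ _ := rfl
  map_add' _ _ := rfl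

theorem co_fnFam_mul (l : ℤ) (f : Fn) (A : OpFam) : co l (fnFam f * A) = f * co l A :=
  fn_ext fun p n => fn_mul_coeff (f.1 p) (A.1 p) l n

theorem co_DFam_mul (l : ℤ) (A : OpFam) :
    co l (DFam * A) = shiftFn (co (l - 1) A) + (shiftFn (co l A) - co l A) :=
  fn_ext fun p n => Dop_mul_coeff (A.1 p) l n

theorem co_mul_DFam (l : ℤ) (A : OpFam) : co l (A * DFam) = co (l - 1) A :=
  fn_ext fun p n => mul_Dop_coeff (A.1 p) l n

theorem co_DinvFam_mul_fnFam (f : Fn) : co (-1) (DinvFam * fnFam f) = shiftFn.symm f :=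
  fn_ext fun p n => Dinv_mul_fn_coeff_neg_one (f.1 p) n

theorem DFam_mul_fnFam (f : Fn) :
    DFam * fnFam f = fnFam (shiftFn f) * DFam + fnFam (shiftFn f - f) :=
  Subtype.ext (funext fun p => Dop_mul_fn (f.1 p))

/-- Families with no powers `Δ^k`, `k > N`. -/
def OrdLE (A : OpFam) (N : ℤ) : Prop := ∀ k, N < k → co k A = 0

theorem ordLE_iff {A : OpFam} {N : ℤ} : OrdLE A N ↔ ∀ p, OrderLE (A.1 p) N := by
  refine ⟨fun h p k hk => funext fun n => ?_, fun h k hk => fn_ext fun p n => ?_⟩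
  · rw [← co_apply, h k hk]; rfl
  · rw [co_apply, h p k hk]; rfl

theorem OrdLE.mul {A B : OpFam} {N M : ℤ} (hA : OrdLE A N) (hB : OrdLE B M) :
    OrdLE (A * B) (N + M) :=
  ordLE_iff.2 fun p => (ordLE_iff.1 hA p).mul (ordLE_iff.1 hB p)

theorem OrdLE.sub {A B : OpFam} {N : ℤ} (hA : OrdLE A N) (hB : OrdLE B N) : OrdLE (A - B) N :=
  fun k hk => by rw [map_sub, hA k hk, hB k hk, sub_zero]

theorem OrdLE.mono {A : OpFam} {N M : ℤ} (hA : OrdLE A N) (h : N ≤ M) : OrdLE A M :=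
  fun k hk => hA k (lt_of_le_of_lt h hk)

theorem ordLE_DFam : OrdLE DFam 1 := ordLE_iff.2 fun _ => orderLE_monomial 1 1

theorem ordLE_DinvFam : OrdLE DinvFam (-1) := ordLE_iff.2 fun _ => orderLE_monomial (-1) 1

theorem ordLE_fnFam (f : Fn) : OrdLE (fnFam f) 0 := ordLE_iff.2 fun _ => orderLE_monomial 0 _

/-- Families of difference operators with only positive powers of `Δ`. -/
def Positive (A : OpFam) : Prop := ∀ k, k < 1 → co k A = 0

/-- For j ≥ 1 the binomial (j choose i) vanishes when i > j, so Δ^j ∘ bΔ^k contains only powers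
Δ^(k+j-i) with k + j - i ≥ k ≥ 1. -/
theorem Positive.mul {A B : OpFam} (hA : Positive A) (hB : Positive B) : Positive (A * B) := by
  intro l hl
  refine fn_ext fun p n => ?_
  obtain ⟨N, hN⟩ := exists_orderLE (A.1 p)
  obtain ⟨M, hM⟩ := exists_orderLE (B.1 p)
  have hA' : ∀ k, k < 1 → (A.1 p).1 k = 0 := fun k hk => funext fun n => by
    rw [← co_apply, hA k hk]; rfl
  have hB' : ∀ k, k < 1 → (B.1 p).1 k = 0 := fun k hk => funext fun n => by
    rw [← co_apply, hB k hk]; rfl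
  change (A.1 p * B.1 p).1 l n = 0
  rw [mul_coeff_eq_sum hN hM l n le_rfl]
  refine Finset.sum_eq_zero fun j _ => ?_
  by_cases hj : j < 1
  · rw [hA' j hj]; simp
  · lift j to ℕ using by omega
    rw [leftShift]
    refine mul_eq_zero_of_right _ ((finsum_congr fun i => ?_).trans finsum_zero)
    by_cases hi : j < i
    · rw [Ring.choose_natCast, Nat.choose_eq_zero_of_lt hi]
      simp
    · rw [hB' _ (by omega), iterate_diff_zero]
      simp

theorem Positive.add {A B : OpFam} (hA : Positive A) (hB : Positive B) : Positive (A + B) :=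
  fun k hk => by rw [map_add, hA k hk, hB k hk, add_zero]

theorem Positive.derivOp {A : OpFam} (hA : Positive A) (v : Param) : Positive (derivOp v A) :=
  fun k hk => by rw [co_derivOp, hA k hk, map_zero]

theorem Positive.eq_fnFam_mul_DFam {A : OpFam} (hA : Positive A) (h1 : OrdLE A 1) :
    A = fnFam (co 1 A) * DFam := by
  refine opFam_ext fun k => ?_
  rw [co_mul_DFam, co_fnFam]
  split_ifs with h
  · rw [show k = 1 by omega]
  · rcases lt_or_gt_of_ne (show k ≠ 1 by omega) with h2 | h2
    · exact hA k h2
    · exact h1 k h2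

/-- `A_{≥ 1}` for families. -/
def geOneFam (A : OpFam) : OpFam := ⟨fun p => geOne (A.1 p), by
  obtain ⟨N, hN⟩ := A.2.1
  refine ⟨⟨N, fun p k hk => ?_⟩, fun k n => ?_⟩
  · simp only [geOne, hN p k hk, ite_self]
  · simp only [geOne]
    split_ifs
    · exact A.2.2 k n
    · exact smooth_const 0⟩

/-- `A_{≤ 0}` for families. -/
def leZeroFam (A : OpFam) : OpFam := ⟨fun p => leZero (A.1 p), by
  refine ⟨⟨0, fun p k hk => if_neg (not_le.2 hk)⟩, fun k n => ?_⟩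
  simp only [leZero]
  split_ifs
  · exact A.2.2 k n
  · exact smooth_const 0⟩

theorem geOneFam_add_leZeroFam (A : OpFam) : geOneFam A + leZeroFam A = A := by
  refine Subtype.ext (funext fun p => op_ext fun k n => ?_)
  change (geOne (A.1 p) + leZero (A.1 p)).1 k n = _
  rw [add_coeff, geOne, leZero]
  by_cases h : 1 ≤ k
  · simp [h, show ¬ k ≤ 0 by omega]
  · simp [h, show k ≤ 0 by omega]

theorem positive_geOneFam (A : OpFam) : Positive (geOneFam A) := fun k hk =>
  fn_ext fun p n => by
    rw [co_apply]
    simp only [geOneFam, geOne, if_neg (not_le.2 hk)]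
    rfl

theorem fn_nsmul_cancel {k : ℕ} (hk : k ≠ 0) {f g : Fn} (h : k • f = k • g) : f = g :=
  fn_ext fun p n => by
    have h1 := congrFun (congrFun (congrArg Subtype.val h) p) n
    have h2 : (k : ℂ) * f.1 p n = (k : ℂ) * g.1 p n := by
      simpa [nsmul_eq_mul] using h1
    exact mul_left_cancel₀ (Nat.cast_ne_zero.2 hk) h2

theorem isUnit_fn {f : Fn} (h : ∀ p n, f.1 p n ≠ 0) : IsUnit f :=
  IsUnit.of_mul_eq_one ⟨fun p n => (f.1 p n)⁻¹, fun n => (f.2 n).inv fun p => h p n⟩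
    (fn_ext fun p n => mul_inv_cancel₀ (h p n))

open PowerSeries
open Finset.HasAntidiagonal (antidiagonal)

/-! ### Power series and the derivation `z d/dz + ∑ z^l ∂_l` -/

/-- Both sides run over all triples a + b + c = k. -/
theorem sum_antidiagonal_right_eq_left {M : Type*} [AddCommMonoid M] (f : ℕ → ℕ → ℕ → M) (k : ℕ) :
    ∑ x ∈ antidiagonal k, ∑ y ∈ antidiagonal x.2, f x.1 y.1 y.2
      = ∑ x ∈ antidiagonal k, ∑ y ∈ antidiagonal x.1, f y.1 y.2 x.2 := by
  simp only [Finset.sum_sigma']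
  refine Finset.sum_nbij' (fun x => ⟨(x.1.1 + x.2.1, x.2.2), (x.1.1, x.2.1)⟩)
    (fun x => ⟨(x.2.1, x.2.2 + x.1.2), (x.2.2, x.1.2)⟩) ?_ ?_ ?_ ?_ ?_ <;>
  rintro ⟨⟨a, b⟩, ⟨c, d⟩⟩ h <;>
  simp only [Finset.mem_sigma, Finset.HasAntidiagonal.mem_antidiagonal] at h ⊢ <;>
  obtain ⟨h1, h2⟩ := h <;> subst h1 <;> subst h2 <;> simp [add_assoc]

theorem sum_antidiagonal_right_swap {M : Type*} [AddCommMonoid M] (f : ℕ → ℕ → ℕ → M) (k : ℕ) :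
    ∑ x ∈ antidiagonal k, ∑ y ∈ antidiagonal x.2, f x.1 y.1 y.2
      = ∑ x ∈ antidiagonal k, ∑ y ∈ antidiagonal x.2, f y.1 x.1 y.2 := by
  simp only [Finset.sum_sigma']
  refine Finset.sum_nbij' (fun x => ⟨(x.2.1, x.1.1 + x.2.2), (x.1.1, x.2.2)⟩)
    (fun x => ⟨(x.2.1, x.1.1 + x.2.2), (x.1.1, x.2.2)⟩) ?_ ?_ ?_ ?_ ?_ <;>
  rintro ⟨⟨a, b⟩, ⟨c, d⟩⟩ h <;>
  simp only [Finset.mem_sigma, Finset.HasAntidiagonal.mem_antidiagonal] at h ⊢ <;>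
  obtain ⟨h1, h2⟩ := h <;> subst h1 <;> subst h2 <;> simp [add_left_comm]

section General

variable {R : Type*} [Ring R] (D : ℕ → R →+ R)

/-- The derivation `z d/dz + ∑_l z^l D_l` on power series. -/
def euler : R⟦X⟧ →+ R⟦X⟧ where
  toFun F := PowerSeries.mk fun k => k • coeff k F +
    ∑ x ∈ antidiagonal k, D x.1 (coeff x.2 F)
  map_zero' := by ext; simp
  map_add' F G := by
    ext k
    simp only [coeff_mk, map_add, smul_add, Finset.sum_add_distrib]
    abel

theorem coeff_euler (F : R⟦X⟧) (k : ℕ) : coeff k (euler D F) = k • coeff k F +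
    ∑ x ∈ antidiagonal k, D x.1 (coeff x.2 F) :=
  PowerSeries.coeff_mk k fun k => k • coeff k F + ∑ x ∈ antidiagonal k, D x.1 (coeff x.2 F)

variable {D}

theorem euler_mul (hD : ∀ l a b, D l (a * b) = D l a * b + a * D l b) (F G : R⟦X⟧) :
    euler D (F * G) = euler D F * G + F * euler D G := by
  ext k
  simp only [coeff_euler, map_add, coeff_mul, map_sum, hD, Finset.sum_add_distrib, add_mul, mul_add,
    Finset.sum_mul, Finset.mul_sum]
  have h1 : k • ∑ x ∈ antidiagonal k, coeff x.1 F * coeff x.2 G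
      = ∑ x ∈ antidiagonal k, x.1 • coeff x.1 F * coeff x.2 G
        + ∑ x ∈ antidiagonal k, coeff x.1 F * x.2 • coeff x.2 G := by
    rw [Finset.smul_sum, ← Finset.sum_add_distrib]
    refine Finset.sum_congr rfl fun x hx => ?_
    rw [← Finset.HasAntidiagonal.mem_antidiagonal.1 hx, add_smul, smul_mul_assoc, mul_smul_comm]
  have h2 : ∑ x ∈ antidiagonal k, ∑ y ∈ antidiagonal x.2,
        D x.1 (coeff y.1 F) * coeff y.2 G
      = ∑ x ∈ antidiagonal k, ∑ y ∈ antidiagonal x.1,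
        D y.1 (coeff y.2 F) * coeff x.2 G :=
    sum_antidiagonal_right_eq_left (fun a b c => D a (coeff b F) * coeff c G) k
  have h3 : ∑ x ∈ antidiagonal k, ∑ y ∈ antidiagonal x.2,
        coeff y.1 F * D x.1 (coeff y.2 G)
      = ∑ x ∈ antidiagonal k, ∑ y ∈ antidiagonal x.2,
        coeff x.1 F * D y.1 (coeff y.2 G) :=
    sum_antidiagonal_right_swap (fun a b c => coeff b F * D a (coeff c G)) k
  rw [h1, h2, h3]
  abel

/-- One equation between series thus encodes all the derivatives D_k a at once. -/
theorem euler_C (a : R) : euler D (C a) = PowerSeries.mk fun k => D k a := by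
  ext k
  rw [coeff_euler, coeff_mk, Finset.sum_eq_single (k, 0)]
  · rw [coeff_C, coeff_C]
    rcases eq_or_ne k 0 with rfl | hk
    · simp
    · simp [hk]
  · intro x hx hne
    rw [coeff_C, if_neg, map_zero]
    intro h0
    have := Finset.HasAntidiagonal.mem_antidiagonal.1 hx
    exact hne (Prod.ext (by simp only; omega) h0)
  · intro h
    exact absurd (Finset.HasAntidiagonal.mem_antidiagonal.2 (add_zero k)) h

theorem euler_C_eq_zero {a : R} (h : ∀ l, D l a = 0) : euler D (C a) = 0 := by
  rw [euler_C]
  ext k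
  simp [h]

theorem euler_X (h1 : ∀ l, D l 1 = 0) : euler D X = X := by
  ext k
  rw [coeff_euler, Finset.sum_eq_zero, add_zero, coeff_X]
  · split_ifs with h
    · simp [h]
    · simp
  · intro x _
    rw [coeff_X]
    split_ifs
    · exact h1 _
    · exact map_zero _

theorem euler_map {S : Type*} [Ring S] {D' : ℕ → S →+ S} (f : R →+* S)
    (h : ∀ l a, D' l (f a) = f (D l a)) (F : R⟦X⟧) :
    euler D' (PowerSeries.map f F) = PowerSeries.map f (euler D F) := by
  ext k
  simp [coeff_euler, h]

end General

/-! ### Time derivatives and the shift t ↦ t - [z] -/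

/-- The direction of `∂/∂t_l`, and `0` for `l = 0`. -/
def tDirNat : ℕ → Param
  | 0 => 0
  | l + 1 => tDir l.succPNat

/-- Time derivatives of functions. -/
def timeFn (l : ℕ) : Fn →+ Fn := derivFn (tDirNat l)

/-- Time derivatives of families of operators. -/
def timeOp (l : ℕ) : OpFam →+ OpFam := derivOp (tDirNat l)

theorem timeFn_zero (f : Fn) : timeFn 0 f = 0 := 
  derivFn_eq fun _ _ => hasLineDerivAt_zero

theorem timeOp_zero (A : OpFam) : timeOp 0 A = 0 := opFam_ext fun k => timeFn_zero (co k A)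

theorem co_timeOp (l : ℕ) (k : ℤ) (A : OpFam) : co k (timeOp l A) = timeFn l (co k A) := rfl

theorem timeFn_mul (l : ℕ) (f g : Fn) : timeFn l (f * g) = timeFn l f * g + f * timeFn l g :=
  derivFn_mul _ f g

theorem timeOp_mul (l : ℕ) (A B : OpFam) :
    timeOp l (A * B) = timeOp l A * B + A * timeOp l B := derivOp_mul _ A B

theorem timeOp_fnFam (l : ℕ) (f : Fn) : timeOp l (fnFam f) = fnFam (timeFn l f) :=
  derivOp_fnFam _ f

theorem timeFn_one (l : ℕ) : timeFn l 1 = 0 := derivFn_one _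

theorem timeOp_one (l : ℕ) : timeOp l 1 = 0 := by
  rw [← map_one fnFam, timeOp_fnFam, timeFn_one, map_zero]

theorem smooth_shiftCoeff {f : Param → ℂ} (hf : Smooth f) (ε : ℂ) (k : ℕ) :
    Smooth (shiftCoeff ε f k) := by
  induction k using Nat.strong_induction_on with
  | _ k ih =>
    cases k with
    | zero => rw [shiftCoeff]; exact hf
    | succ k =>
      rw [shiftCoeff]
      exact (smooth_const _).mul (Smooth.sum fun l _ => (ih (k - l) (by omega)).lineDeriv _)

theorem shiftCoeff_zero_fun (ε : ℂ) (k : ℕ) : shiftCoeff ε (fun _ => 0) k = fun _ => 0 := by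
  induction k using Nat.strong_induction_on with
  | _ k ih =>
    cases k with
    | zero => rw [shiftCoeff]
    | succ k =>
      rw [shiftCoeff]
      funext p
      refine mul_eq_zero_of_right _ (Finset.sum_eq_zero fun l _ => ?_)
      rw [ih (k - l) (by omega)]
      exact (hasLineDerivAt_const 0 p _).lineDeriv

/-- The series `f(t - [z])`. -/
def shiftSeries (f : Fn) : Fn⟦X⟧ := PowerSeries.mk fun k =>
  ⟨fun p n => shiftCoeff (-1) (fun q => f.1 q n) k p, fun n => smooth_shiftCoeff (f.2 n) _ k⟩

theorem coeff_shiftSeries_apply (f : Fn) (k : ℕ) (p : Param) (n : ℤ) :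
    (coeff k (shiftSeries f)).1 p n = shiftCoeff (-1) (fun q => f.1 q n) k p := by
  rw [shiftSeries, coeff_mk]

theorem coeff_zero_shiftSeries (f : Fn) : coeff 0 (shiftSeries f) = f :=
  fn_ext fun p n => by rw [coeff_shiftSeries_apply, shiftCoeff]

theorem sum_val {ι : Type*} (s : Finset ι) (f : ι → Fn) (p : Param) (n : ℤ) :
    (∑ i ∈ s, f i).1 p n = ∑ i ∈ s, (f i).1 p n := by
  simp

/-- Along t - [z] the operator z d/dz acts as -∑ z^l ∂/∂t_l. Coefficientwise this is the recursion
defining `shiftCoeff` with ε = -1. -/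
theorem euler_shiftSeries (f : Fn) : euler timeFn (shiftSeries f) = 0 := by
  ext1 k
  rw [coeff_euler, map_zero]
  cases k with
  | zero => simp [timeFn_zero]
  | succ k =>
    rw [Finset.Nat.sum_antidiagonal_succ, timeFn_zero, zero_add,
      Finset.Nat.sum_antidiagonal_eq_sum_range_succ
        (fun a b => timeFn (a + 1) (coeff b (shiftSeries f)))]
    refine fn_ext fun p n => ?_
    change ((k + 1) • coeff (k + 1) (shiftSeries f)).1 p n + (∑ l ∈ Finset.range (k + 1),
      timeFn (l + 1) (coeff (k - l) (shiftSeries f))).1 p n = 0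
    have h1 : ((k + 1) • coeff (k + 1) (shiftSeries f)).1 p n
        = ((k : ℂ) + 1) * (coeff (k + 1) (shiftSeries f)).1 p n := by
      simp [nsmul_eq_mul]
    have h2 : ∀ l, (timeFn (l + 1) (coeff (k - l) (shiftSeries f))).1 p n
        = lineDeriv ℝ (shiftCoeff (-1) (fun q => f.1 q n) (k - l)) p (tDir l.succPNat) := by
      intro l
      have : (fun q => (coeff (k - l) (shiftSeries f)).1 q n)
        = shiftCoeff (-1) (fun q => f.1 q n) (k - l) :=
        funext fun q => coeff_shiftSeries_apply f _ q n
      rw [← this]; rfl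
    rw [h1, coeff_shiftSeries_apply, shiftCoeff, sum_val]
    simp only [h2]
    rw [Fin.sum_univ_eq_sum_range
      (fun l => lineDeriv ℝ (shiftCoeff (-1) (fun q => f.1 q n) (k - l)) p (tDir l.succPNat))]
    have hk : (k : ℂ) + 1 ≠ 0 := by exact_mod_cast Nat.succ_ne_zero k
    field_simp
    ring

/-- The series `A(t - [z])`. -/
def shiftSeriesOp (A : OpFam) : OpFam⟦X⟧ := PowerSeries.mk fun k =>
  ⟨fun p => ⟨fun j n => shiftCoeff (-1) (fun q => (A.1 q).1 j n) k p, by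
      obtain ⟨N, hN⟩ := A.2.1
      refine ⟨N, fun j hj => funext fun n => ?_⟩
      have : (fun q => (A.1 q).1 j n) = fun _ => 0 := funext fun q => by rw [hN q j hj]; rfl
      simp only [this, shiftCoeff_zero_fun]
      rfl⟩, by
    obtain ⟨N, hN⟩ := A.2.1
    refine ⟨⟨N, fun p j hj => funext fun n => ?_⟩, fun j n => smooth_shiftCoeff (A.2.2 j n) _ k⟩
    have : (fun q => (A.1 q).1 j n) = fun _ => 0 := funext fun q => by rw [hN q j hj]; rfl
    simp only [this, shiftCoeff_zero_fun]
    rfl⟩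

theorem co_coeff_shiftSeriesOp (A : OpFam) (j : ℤ) (k : ℕ) :
    co j (coeff k (shiftSeriesOp A)) = coeff k (shiftSeries (co j A)) := by
  rw [shiftSeriesOp, shiftSeries, coeff_mk, coeff_mk]; rfl

theorem coeff_zero_shiftSeriesOp (A : OpFam) : coeff 0 (shiftSeriesOp A) = A :=
  opFam_ext fun j => by rw [co_coeff_shiftSeriesOp, coeff_zero_shiftSeries]

theorem shiftSeries_zero : shiftSeries 0 = 0 := by
  ext1 k
  refine fn_ext fun p n => ?_
  rw [coeff_shiftSeries_apply]
  exact congrFun (shiftCoeff_zero_fun (-1) k) p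

theorem ordLE_coeff_shiftSeriesOp {A : OpFam} {N : ℤ} (h : OrdLE A N) (k : ℕ) :
    OrdLE (coeff k (shiftSeriesOp A)) N := fun j hj => by
  rw [co_coeff_shiftSeriesOp, h j hj, shiftSeries_zero, map_zero]

theorem euler_shiftSeriesOp (A : OpFam) : euler timeOp (shiftSeriesOp A) = 0 := by
  ext1 k
  refine opFam_ext fun j => ?_
  have h := congrArg (coeff k) (euler_shiftSeries (co j A))
  rw [coeff_euler] at h ⊢
  simpa only [map_add, map_nsmul, map_sum, co_timeOp, co_coeff_shiftSeriesOp, map_zero] using h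

/-! ### The first order dressing of the shift `t ↦ t - [z]` -/

/-- Smooth families solving Sato's equations. -/
structure IsSato (Z Zi : OpFam) : Prop where
  ord : OrdLE Z 0
  ord_inv : OrdLE Zi 0
  isUnit_lead : IsUnit (co 0 Z)
  mul_inv : Z * Zi = 1
  inv_mul : Zi * Z = 1
  sato : ∀ l, timeOp (l + 1) Z = -(leZeroFam ((Z * DFam * Zi) ^ (l + 1)) * Z)

/-- The series `∑_{l ≥ 1} z^l (L^l)_{≥ 1}`. -/
def posSeries (L : OpFam) : OpFam⟦X⟧ := PowerSeries.mk fun l => if l = 0 then 0 else geOneFam (L ^ l)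

/-- The series `Z(t - [z]) (1 - z Δ)`. -/
def shiftDressing (Z : OpFam) : OpFam⟦X⟧ := shiftSeriesOp Z * (1 - X * C DFam)

/-- The series `Z(t - [z]) (1 - z Δ) Z(t)⁻¹`. -/
def transition (Z Zi : OpFam) : OpFam⟦X⟧ := shiftDressing Z * C Zi

theorem coeff_zero_shiftDressing (Z : OpFam) : coeff 0 (shiftDressing Z) = Z := by
  rw [shiftDressing, mul_sub, mul_one, ← mul_assoc, map_sub, coeff_mul_C, coeff_zero_mul_X,
    coeff_zero_shiftSeriesOp, zero_mul, sub_zero]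

theorem coeff_succ_shiftDressing (Z : OpFam) (k : ℕ) : coeff (k + 1) (shiftDressing Z)
    = coeff (k + 1) (shiftSeriesOp Z) - coeff k (shiftSeriesOp Z) * DFam := by
  rw [shiftDressing, mul_sub, mul_one, ← mul_assoc, map_sub, coeff_mul_C, coeff_succ_mul_X]

theorem timeOp_DFam (l : ℕ) : timeOp l DFam = 0 := derivOp_DFam _

variable {Z Zi : OpFam}

theorem IsSato.lax_pow_mul (h : IsSato Z Zi) (l : ℕ) :
    (Z * DFam * Zi) ^ l * Z = Z * DFam ^ l := by
  induction l with
  | zero => simp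
  | succ l ih =>
    rw [pow_succ, mul_assoc, mul_assoc (Z * DFam), h.inv_mul, mul_one, ← mul_assoc, ih, mul_assoc,
      ← pow_succ]

/-- E kills Z(t - [z]), sends 1 - zΔ to -zΔ, and Z to -QZ with Q = ∑ z^l (L^l)_{≤ 0} by Sato's
equations. Since (P + Q)Z = ZN with N = ∑_{l ≥ 1} z^l Δ^l, replacing Q by P creates a term which
cancels the -zΔ. -/
theorem IsSato.euler_transition (h : IsSato Z Zi) :
    euler timeOp (transition Z Zi) + transition Z Zi * posSeries (Z * DFam * Zi) = 0 := by
  set L := Z * DFam * Zi with hL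
  set T := transition Z Zi with hT
  set U := shiftDressing Z with hU
  set V := shiftSeriesOp Z with hV
  set P := posSeries L with hP
  let Q : OpFam⟦X⟧ := PowerSeries.mk fun l => if l = 0 then 0 else leZeroFam (L ^ l)
  let N : OpFam⟦X⟧ := PowerSeries.mk fun l => if l = 0 then 0 else DFam ^ l
  have hZ : euler timeOp (C Z) = -(Q * C Z) := by
    rw [euler_C]
    ext1 k
    rw [coeff_mk, map_neg, coeff_mul_C, coeff_mk]
    cases k with
    | zero => simp [timeOp_zero]
    | succ k => rw [h.sato, if_neg (Nat.succ_ne_zero k)]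
  have hPQ : (P + Q) * C Z = C Z * N := by
    ext1 k
    rw [coeff_mul_C, coeff_C_mul, map_add, hP, posSeries, coeff_mk, coeff_mk, coeff_mk]
    split_ifs with hk
    · simp
    · rw [geOneFam_add_leZeroFam, h.lax_pow_mul]
  -- Geometric series: N = zΔ (1 - zΔ)⁻¹.
  have hN : (1 - X * C DFam) * N = X * C DFam := by
    rw [sub_mul, one_mul, sub_eq_iff_eq_add, mul_assoc]
    ext1 k
    cases k with
    | zero => simp [N]
    | succ k =>
      rw [map_add, coeff_succ_X_mul, coeff_succ_X_mul, coeff_C_mul, coeff_mk, coeff_mk, coeff_C]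
      rcases eq_or_ne k 0 with rfl | hk
      · simp
      · simp [hk, pow_succ']
  have hE : euler timeOp (1 - X * C DFam) = -(X * C DFam) := by
    rw [map_sub, euler_mul timeOp_mul, euler_X timeOp_one,
      euler_C_eq_zero (a := DFam) timeOp_DFam, ← map_one C,
      euler_C_eq_zero (a := (1 : OpFam)) timeOp_one]
    simp
  have hEU : euler timeOp U = -(V * (X * C DFam)) := by
    rw [hU, shiftDressing, euler_mul timeOp_mul, euler_shiftSeriesOp, hE]
    noncomm_ring
  have hTZ : T * C Z = U := by
    rw [hT, transition, mul_assoc, ← map_mul, h.inv_mul, map_one, mul_one]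
  have h1 : euler timeOp U = euler timeOp T * C Z - T * Q * C Z := by
    rw [← hTZ, euler_mul timeOp_mul, hZ]
    noncomm_ring
  have h2 : (euler timeOp T + T * P) * C Z = 0 := by
    have h3 : T * ((P + Q) * C Z) = V * (X * C DFam) := by
      rw [hPQ, ← mul_assoc, hTZ, hU, shiftDressing, mul_assoc, hN]
    calc (euler timeOp T + T * P) * C Z
        = (euler timeOp T * C Z - T * Q * C Z) + T * ((P + Q) * C Z) := by noncomm_ring
      _ = 0 := by rw [← h1, h3, hEU, neg_add_cancel]
  calc euler timeOp T + T * P = (euler timeOp T + T * P) * C Z * C Zi := by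
        rw [mul_assoc, ← map_mul, h.mul_inv, map_one, mul_one]
    _ = 0 := by rw [h2, zero_mul]

theorem positive_zero : Positive 0 := fun _ _ => map_zero _

theorem Positive.sum {ι : Type*} {s : Finset ι} {f : ι → OpFam} (h : ∀ i ∈ s, Positive (f i)) :
    Positive (∑ i ∈ s, f i) := fun k hk => by
  rw [map_sum]
  exact Finset.sum_eq_zero fun i hi => h i hi k hk

theorem Positive.of_nsmul {A : OpFam} {k : ℕ} (hk : k ≠ 0) (h : Positive (k • A)) : Positive A :=
  fun j hj => fn_nsmul_cancel hk (by rw [← map_nsmul, h j hj, smul_zero])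

theorem positive_coeff_posSeries (L : OpFam) (k : ℕ) : Positive (coeff k (posSeries L)) := by
  rw [posSeries, coeff_mk]
  split_ifs
  · exact positive_zero
  · exact positive_geOneFam _

theorem IsSato.coeff_zero_transition (h : IsSato Z Zi) : coeff 0 (transition Z Zi) = 1 := by
  rw [transition, coeff_mul_C, coeff_zero_shiftDressing, h.mul_inv]

/-- The coefficient of z^k in E T = -T P expresses k T_k through lower coefficients of T, their time
derivatives and P. The constant term T_0 = 1 has zero derivative and contributes only the
coefficient of P, so positivity propagates. -/
theorem IsSato.positive_coeff_transition (h : IsSato Z Zi) (k : ℕ) (hk : k ≠ 0) :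
    Positive (coeff k (transition Z Zi)) := by
  induction k using Nat.strong_induction_on with
  | _ k ih =>
    refine Positive.of_nsmul hk ?_
    have h1 := congrArg (coeff k) h.euler_transition
    rw [map_add, coeff_euler, map_zero, coeff_mul, add_assoc] at h1
    rw [eq_neg_of_add_eq_zero_left h1]
    have hT : ∀ x ∈ antidiagonal k, x.2 < k → ∀ l, Positive (timeOp l (coeff x.2 (transition Z Zi))) := by
      intro x _ hx l
      rcases eq_or_ne x.2 0 with h0 | h0
      · rw [h0, h.coeff_zero_transition, timeOp_one]
        exact positive_zero
      · exact (ih x.2 hx h0).derivOp _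
    intro j hj
    rw [map_neg, neg_eq_zero]
    refine Positive.add (Positive.sum fun x hx => ?_) (Positive.sum fun x hx => ?_) j hj
    · have hsum := Finset.HasAntidiagonal.mem_antidiagonal.1 hx
      rcases eq_or_ne x.1 0 with h0 | h0
      · rw [h0, timeOp_zero]
        exact positive_zero
      · exact hT x hx (by omega) _
    · have hsum := Finset.HasAntidiagonal.mem_antidiagonal.1 hx
      have hP := positive_coeff_posSeries (Z * DFam * Zi)
      rcases eq_or_ne x.2 0 with h0 | h0
      · rw [h0, posSeries, coeff_mk, if_pos rfl, mul_zero]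
        exact positive_zero
      · rcases eq_or_ne x.1 0 with h1 | h1
        · rw [h1, h.coeff_zero_transition, one_mul]
          exact hP _
        · exact (ih x.1 (by omega) h1).mul (hP _)

/-- Only the factor 1 - zΔ raises the order. Together with positivity this leaves nothing but Δ¹
beyond the constant term. -/
theorem IsSato.ordLE_coeff_transition (h : IsSato Z Zi) (k : ℕ) :
    OrdLE (coeff k (transition Z Zi)) 1 := by
  rw [transition, coeff_mul_C]
  have hV := ordLE_coeff_shiftSeriesOp h.ord
  have hU : OrdLE (coeff k (shiftDressing Z)) 1 := by
    cases k with
    | zero => rw [coeff_zero_shiftDressing]; exact h.ord.mono (by norm_num)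
    | succ k =>
      rw [coeff_succ_shiftDressing]
      exact ((hV _).mono (by norm_num)).sub (((hV k).mul ordLE_DFam).mono (by norm_num))
  exact (hU.mul h.ord_inv).mono (by norm_num)

/-- The transition operator has the form `1 + c Δ`; this is the series `c`. -/
def transitionCoeff (Z Zi : OpFam) : Fn⟦X⟧ := PowerSeries.mk fun k =>
  if k = 0 then 0 else co 1 (coeff k (transition Z Zi))

theorem coeff_zero_transitionCoeff : coeff 0 (transitionCoeff Z Zi) = 0 := by
  rw [transitionCoeff, coeff_mk, if_pos rfl]

theorem IsSato.transition_eq (h : IsSato Z Zi) :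
    transition Z Zi = 1 + PowerSeries.map fnFam (transitionCoeff Z Zi) * C DFam := by
  ext1 k
  rw [map_add, coeff_mul_C, coeff_map, transitionCoeff, coeff_mk, coeff_one]
  split_ifs with hk
  · rw [hk, h.coeff_zero_transition]; simp
  · rw [zero_add]
    exact (h.positive_coeff_transition k hk).eq_fnFam_mul_DFam (h.ordLE_coeff_transition k)

theorem euler_map_fnFam (F : Fn⟦X⟧) :
    euler timeOp (PowerSeries.map fnFam F) = PowerSeries.map fnFam (euler timeFn F) :=
  euler_map fnFam timeOp_fnFam F

/-- As E(1 + cΔ) = (E c)Δ, the equation for T controls all the operators (L^l)_{≥ 1} by one scalar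
series. -/
theorem IsSato.transition_mul_posSeries (h : IsSato Z Zi) :
    (1 + PowerSeries.map fnFam (transitionCoeff Z Zi) * C DFam) * posSeries (Z * DFam * Zi)
      = -(PowerSeries.map fnFam (euler timeFn (transitionCoeff Z Zi)) * C DFam) := by
  have h1 := h.euler_transition
  rw [h.transition_eq, map_add, euler_mul timeOp_mul, euler_map_fnFam, ← map_one C,
    euler_C_eq_zero (a := (1 : OpFam)) timeOp_one,
    euler_C_eq_zero (a := DFam) timeOp_DFam, mul_zero, add_zero, zero_add, map_one,
    add_comm] at h1
  exact eq_neg_of_add_eq_zero_left h1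

/-! ### Symbols -/

/-- The symbol `∑ z^k a_{-k}` of an operator of order `≤ 0`. -/
def symbol : OpFam →+ Fn⟦X⟧ where
  toFun A := PowerSeries.mk fun k => co (-k) A
  map_zero' := by ext1 k; rw [coeff_mk, map_zero, map_zero]
  map_add' A B := by ext1 k; rw [coeff_mk, map_add, map_add, coeff_mk, coeff_mk]

theorem coeff_symbol (A : OpFam) (k : ℕ) : coeff k (symbol A) = co (-k) A :=
  coeff_mk k fun k : ℕ => co (-(k : ℤ)) A

theorem symbol_fnFam_mul (f : Fn) (A : OpFam) : symbol (fnFam f * A) = C f * symbol A := by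
  ext1 k
  rw [coeff_C_mul, coeff_symbol, coeff_symbol, co_fnFam_mul]

/-- The shift on power series. -/
abbrev shiftPS : Fn⟦X⟧ →+* Fn⟦X⟧ := PowerSeries.map (shiftFn : Fn →+* Fn)

/-- One has Δ(σ(1+λ)^n) = ((1+λ)Γσ - σ)(1+λ)^n. Since ΔA may have order 1, the identity is
multiplied by z = λ⁻¹; hence the index 1 - k. -/
theorem symbol_DFam_mul {A : OpFam} (hA : OrdLE A 0) :
    PowerSeries.mk (fun k : ℕ => co (1 - k) (DFam * A))
      = (1 + X) * shiftPS (symbol A) - X * symbol A := by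
  ext1 k
  rw [coeff_mk, co_DFam_mul, add_mul, one_mul, map_sub, map_add, coeff_map, coeff_symbol]
  cases k with
  | zero =>
    rw [coeff_zero_X_mul, coeff_zero_X_mul, hA (1 - (0 : ℕ)) (by norm_num)]
    simp
  | succ k =>
    rw [coeff_succ_X_mul, coeff_succ_X_mul, coeff_map, coeff_symbol]
    have e1 : (1 : ℤ) - ((k + 1 : ℕ) : ℤ) - 1 = -((k + 1 : ℕ) : ℤ) := by ring
    have e2 : (1 : ℤ) - ((k + 1 : ℕ) : ℤ) = -(k : ℤ) := by push_cast; ring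
    rw [e1, e2]
    exact (add_sub_assoc _ _ _).symm

/-- This is (1 + cΔ)w = 0, multiplied by z: the factor 1 - zΔ of T kills (1+λ)^n when z = λ⁻¹. -/
theorem IsSato.transitionCoeff_mul (h : IsSato Z Zi) :
    transitionCoeff Z Zi * ((1 + X) * shiftPS (symbol Z) - X * symbol Z) = -(X * symbol Z) := by
  rw [← symbol_DFam_mul h.ord]
  have hTZ : ∀ k, k ≠ 0 → fnFam (coeff k (transitionCoeff Z Zi)) * (DFam * Z)
      = coeff k (shiftDressing Z) := by
    intro k hk
    have h1 : transition Z Zi * C Z = shiftDressing Z := by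
      rw [transition, mul_assoc, ← map_mul, h.inv_mul, map_one, mul_one]
    rw [← h1, h.transition_eq, coeff_mul_C, map_add, coeff_one, if_neg hk, zero_add, coeff_mul_C,
      coeff_map, mul_assoc]
  ext1 m
  rw [coeff_mul, map_neg]
  cases m with
  | zero => simp [coeff_zero_transitionCoeff]
  | succ m =>
    rw [coeff_succ_X_mul, coeff_symbol, Finset.Nat.sum_antidiagonal_succ, coeff_zero_transitionCoeff,
      zero_mul, zero_add]
    simp only [coeff_mk, ← co_fnFam_mul, hTZ _ (Nat.succ_ne_zero _), coeff_succ_shiftDressing,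
      map_sub, co_mul_DFam]
    rw [Finset.Nat.sum_antidiagonal_eq_sum_range_succ (fun a b =>
      co (1 - (b : ℤ)) (coeff (a + 1) (shiftSeriesOp Z)) -
        co (1 - (b : ℤ) - 1) (coeff a (shiftSeriesOp Z)))]
    -- The sum telescopes. Its lower end is the coefficient of Δ^(-m) in Z, and its upper end is a
    -- coefficient of Δ¹, which vanishes by the order bound.
    have h2 : ∀ a ∈ Finset.range (m + 1),
        co (1 - ((m - a : ℕ) : ℤ)) (coeff (a + 1) (shiftSeriesOp Z)) -
          co (1 - ((m - a : ℕ) : ℤ) - 1) (coeff a (shiftSeriesOp Z))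
        = co (((a + 1 : ℕ) : ℤ) - m) (coeff (a + 1) (shiftSeriesOp Z)) -
          co ((a : ℤ) - m) (coeff a (shiftSeriesOp Z)) := by
      intro a ha
      rw [Finset.mem_range] at ha
      congr 3 <;> push_cast [Nat.cast_sub (show a ≤ m by omega)] <;> ring
    rw [Finset.sum_congr rfl h2, Finset.sum_range_sub
      (fun a => co ((a : ℤ) - m) (coeff a (shiftSeriesOp Z))), coeff_zero_shiftSeriesOp,
      ordLE_coeff_shiftSeriesOp h.ord (m + 1) _ (by push_cast; omega)]
    simp

theorem IsSato.isUnit_symbol (h : IsSato Z Zi) : IsUnit (symbol Z) := by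
  rw [isUnit_iff_constantCoeff, ← coeff_zero_eq_constantCoeff_apply, coeff_symbol]
  simpa using h.isUnit_lead

theorem IsSato.isUnit_symbol_DFam_mul (h : IsSato Z Zi) :
    IsUnit ((1 + X) * shiftPS (symbol Z) - X * symbol Z) := by
  rw [isUnit_iff_constantCoeff]
  have h1 : IsUnit (shiftFn (co 0 Z)) := h.isUnit_lead.map (shiftFn : Fn →+* Fn)
  have h2 : constantCoeff (shiftPS (symbol Z)) = shiftFn (co 0 Z) := by
    rw [← coeff_zero_eq_constantCoeff_apply, coeff_map, coeff_symbol]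
    rfl
  simpa only [map_sub, map_mul, map_add, map_one, constantCoeff_X, add_zero, one_mul, zero_mul,
    sub_zero, h2] using h1

/-! ### Shifted adjoint eigenfunctions and squared eigenfunction potentials -/

/-- The family `Δ⁻¹ (Γψ) Δ`. -/
def conjFam (ψ : Fn) : OpFam := DinvFam * fnFam (shiftFn ψ) * DFam

/-- The series `H` with `Δ⁻¹ (Γψ) Δ w = H w` on the wave function `w`. -/
def shiftedAdjoint (Z : OpFam) (ψ : Fn) : Fn⟦X⟧ :=
  symbol (conjFam ψ * Z) * Ring.inverse (symbol Z)

theorem IsSato.shiftedAdjoint_mul (h : IsSato Z Zi) (ψ : Fn) :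
    shiftedAdjoint Z ψ * symbol Z = symbol (conjFam ψ * Z) := by
  rw [shiftedAdjoint, mul_assoc, Ring.inverse_mul_cancel _ h.isUnit_symbol, mul_one]

/-- Applying Δ to Hw = Δ⁻¹(Γψ)Δw gives ΓH · Δw + ΔH · w = Γψ · Δw. Substitute w = -cΔw and cancel
Δw, whose symbol (times z) has the invertible leading coefficient Γz₀. -/
theorem IsSato.shiftPS_shiftedAdjoint (h : IsSato Z Zi) (ψ : Fn) :
    shiftPS (shiftedAdjoint Z ψ) - transitionCoeff Z Zi *
      (shiftPS (shiftedAdjoint Z ψ) - shiftedAdjoint Z ψ) = C (shiftFn ψ) := by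
  set H := shiftedAdjoint Z ψ with hH
  have hHZ : H * symbol Z = symbol (conjFam ψ * Z) := h.shiftedAdjoint_mul ψ
  have hord : OrdLE (conjFam ψ * Z) 0 :=
    ((((ordLE_DinvFam.mul (ordLE_fnFam _)).mul ordLE_DFam).mul h.ord)).mono (by norm_num)
  have h1 := symbol_DFam_mul hord
  have h2 : DFam * (conjFam ψ * Z) = fnFam (shiftFn ψ) * (DFam * Z) := by
    rw [conjFam]
    simp only [← mul_assoc]
    rw [DFam_mul_DinvFam, one_mul]
  have h3 : PowerSeries.mk (fun k : ℕ => co (1 - k) (fnFam (shiftFn ψ) * (DFam * Z)))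
      = C (shiftFn ψ) * ((1 + X) * shiftPS (symbol Z) - X * symbol Z) := by
    rw [← symbol_DFam_mul h.ord]
    ext1 k
    rw [coeff_C_mul, coeff_mk, coeff_mk, co_fnFam_mul]
  rw [h2, h3, ← hHZ, map_mul] at h1
  have h4 := h.transitionCoeff_mul
  refine h.isUnit_symbol_DFam_mul.mul_right_cancel ?_
  linear_combination -h1 - (shiftPS H - H) * h4

/-- The operator `Δ⁻¹ q A φ` evaluated coefficientwise at `Δ^0`. -/
def pairing (q φ : Fn) (A : OpFam⟦X⟧) : Fn⟦X⟧ :=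
  PowerSeries.mk fun k => co 0 (DinvFam * fnFam q * coeff k A * fnFam φ)

theorem co_zero_conj (g φ : Fn) :
    co 0 (DinvFam * fnFam g * DFam * fnFam φ) = φ * shiftFn.symm g := by
  have h : DinvFam * fnFam g * DFam * fnFam φ = DinvFam * fnFam (g * shiftFn φ) * DFam
      + DinvFam * fnFam (g * (shiftFn φ - φ)) := by
    rw [mul_assoc _ DFam, DFam_mul_fnFam, mul_add, map_mul, map_mul]
    noncomm_ring
  rw [h, map_add, co_mul_DFam, zero_sub, co_DinvFam_mul_fnFam, map_mul, RingEquiv.symm_apply_apply,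
    (ordLE_DinvFam.mul (ordLE_fnFam _)) 0 (by norm_num), add_zero, mul_comm]

/-- The relation between H and c yields the operator identity ΔH · (1 + cΔ) = Δ ∘ (H - ψ) + Δψ,
where ΔH and Δψ are functions. Multiplying by P on the right and Δ⁻¹ on the left and using (1 + cΔ)P
= -(E c)Δ gives Δ⁻¹(Δψ)P = -Δ⁻¹(ΔH · E c)Δ - (H - ψ)P. Then compose with φ and take the coefficient
of Δ⁰. -/
theorem IsSato.pairing_posSeries (h : IsSato Z Zi) (ψ φ : Fn) :
    pairing (shiftFn ψ - ψ) φ (posSeries (Z * DFam * Zi))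
      = -(C φ * PowerSeries.map (shiftFn.symm : Fn →+* Fn)
          ((shiftPS (shiftedAdjoint Z ψ) - shiftedAdjoint Z ψ) *
            euler timeFn (transitionCoeff Z Zi)))
        - (shiftedAdjoint Z ψ - C ψ) *
          PowerSeries.mk fun k => co 0 (coeff k (posSeries (Z * DFam * Zi)) * fnFam φ) := by
  set H := shiftedAdjoint Z ψ with hH
  set c := transitionCoeff Z Zi with hc
  set P := posSeries (Z * DFam * Zi) with hP
  have hHc := h.shiftPS_shiftedAdjoint ψ
  rw [← hH, ← hc] at hHc
  have hcomm : ∀ F : Fn⟦X⟧, C DFam * PowerSeries.map fnFam F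
      = PowerSeries.map fnFam (shiftPS F) * C DFam + PowerSeries.map fnFam (shiftPS F - F) := by
    intro F
    ext1 k
    simp only [coeff_C_mul, map_add, coeff_mul_C, coeff_map, DFam_mul_fnFam, map_sub]
    rfl
  have h1 : PowerSeries.map fnFam (shiftPS H - H) * (1 + PowerSeries.map fnFam c * C DFam)
      = C DFam * PowerSeries.map fnFam (H - C ψ) + C (fnFam (shiftFn ψ - ψ)) := by
    have e1 : shiftPS (H - C ψ) = (shiftPS H - H) * c := by
      rw [map_sub, map_C]
      change shiftPS H - C (shiftFn ψ) = _
      linear_combination hHc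
    have e2 : shiftPS (H - C ψ) - (H - C ψ) = (shiftPS H - H) - C (shiftFn ψ - ψ) := by
      rw [map_sub, map_C, map_sub C]
      change shiftPS H - C (shiftFn ψ) - _ = _
      ring
    rw [hcomm, e2, e1, map_mul, map_sub (PowerSeries.map fnFam) _ (C _), map_C]
    noncomm_ring
  have h2 : C DinvFam * C (fnFam (shiftFn ψ - ψ)) * P
      = -(C DinvFam * PowerSeries.map fnFam ((shiftPS H - H) * euler timeFn c) * C DFam)
        - PowerSeries.map fnFam (H - C ψ) * P := by
    have h3 : C (fnFam (shiftFn ψ - ψ)) * P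
        = PowerSeries.map fnFam (shiftPS H - H) *
            ((1 + PowerSeries.map fnFam c * C DFam) * P)
          - C DFam * PowerSeries.map fnFam (H - C ψ) * P := by
      rw [← mul_assoc, h1]
      noncomm_ring
    have h4 : C DinvFam * C DFam = (1 : OpFam⟦X⟧) := by
      rw [← map_mul, DinvFam_mul_DFam, map_one]
    rw [mul_assoc, h3, h.transition_mul_posSeries, ← hc, mul_sub, ← mul_assoc (C DinvFam) (C DFam * _),
      ← mul_assoc (C DinvFam) (C DFam), h4, map_mul]
    noncomm_ring
  generalize (shiftPS H - H) * euler timeFn c = F at h2 ⊢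
  generalize H - C ψ = v at h2 ⊢
  generalize shiftFn ψ - ψ = q at h2 ⊢
  ext1 k
  have h5 := congrArg (fun F => co 0 (coeff k F * fnFam φ)) h2
  simp only [map_sub, map_neg, ← map_mul C, coeff_C_mul, coeff_mul_C, sub_mul, neg_mul,
    coeff_map, co_zero_conj] at h5
  rw [pairing, coeff_mk, h5, map_sub, map_neg, coeff_C_mul, coeff_map, coeff_mul, coeff_mul,
    Finset.sum_mul, map_sum]
  congr 1
  refine Finset.sum_congr rfl fun x _ => ?_
  rw [coeff_map, mul_assoc, co_fnFam_mul, coeff_mk]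

/-! ### Time derivatives of ψ, of the potentials and of H -/

theorem euler_timeFn_C (f : Fn) : euler timeFn (C f) = PowerSeries.mk fun k => timeFn k f :=
  euler_C f

/-- Eigenfunctions, adjoint eigenfunctions and squared eigenfunction potentials as smooth
functions. -/
structure IsSquaredEigen (L : OpFam) (φ ψ S : Fn) : Prop where
  eigen : ∀ k, timeFn k φ = co 0 (coeff k (posSeries L) * fnFam φ)
  adjoint : ∀ k, timeFn k ψ = co 0 (DinvFam * fnFam (shiftFn ψ - ψ) * coeff k (posSeries L))
  potential : ∀ k,
    timeFn k S = co 0 (DinvFam * fnFam (shiftFn ψ - ψ) * coeff k (posSeries L) * fnFam φ)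

variable {φ ψ S : Fn}

/-- The pairing formula with φ = 1: the last term drops out because P has only positive powers of Δ
and kills constants. -/
theorem euler_C_adjoint (h : IsSato Z Zi) (hs : IsSquaredEigen (Z * DFam * Zi) φ ψ S) :
    euler timeFn (C ψ) = -PowerSeries.map (shiftFn.symm : Fn →+* Fn)
      ((shiftPS (shiftedAdjoint Z ψ) - shiftedAdjoint Z ψ) *
        euler timeFn (transitionCoeff Z Zi)) := by
  have h1 := h.pairing_posSeries ψ 1
  have h2 : (PowerSeries.mk fun k => co 0 (coeff k (posSeries (Z * DFam * Zi)) * fnFam 1)) = 0 := by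
    ext1 k
    rw [coeff_mk, map_one, mul_one, positive_coeff_posSeries _ _ 0 (by norm_num), map_zero]
  rw [h2, mul_zero, sub_zero, map_one, one_mul] at h1
  rw [← h1, euler_timeFn_C, pairing]
  ext1 k
  rw [coeff_mk, coeff_mk, map_one, mul_one, hs.adjoint]

/-- In the pairing formula the first term is φ times the value found for Eψ, and the eigenfunction
equation turns the last factor into Eφ. -/
theorem euler_C_potential (h : IsSato Z Zi) (hs : IsSquaredEigen (Z * DFam * Zi) φ ψ S) :
    euler timeFn (C S) = C φ * euler timeFn (C ψ)
      - (shiftedAdjoint Z ψ - C ψ) * euler timeFn (C φ) := by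
  have h1 := h.pairing_posSeries ψ φ
  have h2 : (PowerSeries.mk fun k => co 0 (coeff k (posSeries (Z * DFam * Zi)) * fnFam φ))
      = euler timeFn (C φ) := by
    rw [euler_timeFn_C]
    ext1 k
    rw [coeff_mk, coeff_mk, hs.eigen]
  have h3 : pairing (shiftFn ψ - ψ) φ (posSeries (Z * DFam * Zi)) = euler timeFn (C S) := by
    rw [euler_timeFn_C, pairing]
    ext1 k
    rw [coeff_mk, coeff_mk, hs.potential]
  rw [← h3, h1, h2, euler_C_adjoint h hs]
  ring

theorem euler_shiftPS (F : Fn⟦X⟧) : euler timeFn (shiftPS F) = shiftPS (euler timeFn F) :=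
  euler_map _ (fun _ _ => rfl) F

/-- Apply E to the relation between H and c. The terms with E c cancel against EΓψ, leaving ΓEH =
c(ΓEH - EH); since c has no constant term, all coefficients of EH vanish inductively. As H has
constant term ψ, it follows that H = ψ(t - [z]). -/
theorem euler_shiftedAdjoint (h : IsSato Z Zi) (hs : IsSquaredEigen (Z * DFam * Zi) φ ψ S) :
    euler timeFn (shiftedAdjoint Z ψ) = 0 := by
  set H := shiftedAdjoint Z ψ with hH
  set c := transitionCoeff Z Zi with hc
  have h1 := congrArg (euler timeFn) (h.shiftPS_shiftedAdjoint ψ)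
  have h2 : shiftPS (euler timeFn (C ψ)) = -((shiftPS H - H) * euler timeFn c) := by
    rw [euler_C_adjoint h hs, map_neg, ← hH, ← hc]
    congr 1
    ext1 k
    rw [coeff_map, coeff_map]
    exact shiftFn.apply_symm_apply _
  have h3 : euler timeFn (C (shiftFn ψ)) = shiftPS (euler timeFn (C ψ)) := by
    rw [← euler_shiftPS, map_C]
    rfl
  rw [h3, h2, ← hH, ← hc, map_sub, euler_mul timeFn_mul, map_sub, euler_shiftPS] at h1
  have h4 : shiftPS (euler timeFn H) = c * (shiftPS (euler timeFn H) - euler timeFn H) := by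
    linear_combination h1
  ext1 k
  rw [map_zero]
  induction k using Nat.strong_induction_on with
  | _ k ih =>
    have h5 := congrArg (coeff k) h4
    rw [coeff_mul, Finset.sum_eq_zero, coeff_map] at h5
    · exact shiftFn.map_eq_zero_iff.1 h5
    · intro x hx
      have hsum := Finset.HasAntidiagonal.mem_antidiagonal.1 hx
      rcases eq_or_ne x.1 0 with h0 | h0
      · rw [h0, hc, coeff_zero_transitionCoeff, zero_mul]
      · rw [map_sub, coeff_map, ih x.2 (by omega), map_zero, sub_zero, mul_zero]

/-- The time derivatives of `Ŝ = φψ - S` are those of `φ(t) H(t)`. -/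
theorem euler_C_hatS (h : IsSato Z Zi) (hs : IsSquaredEigen (Z * DFam * Zi) φ ψ S) :
    euler timeFn (C (φ * ψ - S)) = euler timeFn (C φ * shiftedAdjoint Z ψ) := by
  -- Both sides equal H · Eφ.
  rw [map_sub C, map_mul C, map_sub, euler_mul timeFn_mul, euler_mul timeFn_mul,
    euler_C_potential h hs, euler_shiftedAdjoint h hs]
  ring

/-! ### The inverse of a dressing operator -/

/-- If B has order at most d + 1 with d ≥ 0, the coefficient of Δ^(d+1) in AB is a₀ b_{d+1} and must
vanish; so the order bound drops step by step to 0. -/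
theorem orderLE_zero_of_mul_eq_one {A B : Op} (hA : OrderLE A 0) (h0 : ∀ n, A.1 0 n ≠ 0)
    (h : A * B = 1) : OrderLE B 0 := by
  obtain ⟨M, hM⟩ := exists_orderLE B
  have key : ∀ d : ℕ, OrderLE B d → OrderLE B 0 := by
    intro d
    induction d with
    | zero => exact fun h => h
    | succ d ih =>
      intro hB
      refine ih fun k hk => ?_
      rcases lt_or_ge ((d + 1 : ℕ) : ℤ) k with h1 | h1
      · exact hB k h1
      · obtain rfl : k = ((d + 1 : ℕ) : ℤ) := by push_cast at h1 ⊢; omega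
        funext n
        have h2 := congrFun (congrFun (congrArg Subtype.val h) ((d + 1 : ℕ) : ℤ)) n
        rw [mul_coeff_eq_sum hA hB _ n (J := 0) (by omega)] at h2
        rw [Finset.Icc_self, Finset.sum_singleton, leftShift_zero] at h2
        have h3 : (1 : Op).1 ((d + 1 : ℕ) : ℤ) n = 0 := by
          change (fn 1).1 _ n = 0
          rw [fn_coeff, if_neg (by omega)]
        rw [h3] at h2
        exact (mul_eq_zero.1 h2).resolve_left (h0 n)
  exact key M.toNat (hM.mono (by omega))

/-- The equation Z Z⁻¹ = 1 at Δ^(-k) gives the coefficient of Δ^(-k) in Z⁻¹ as a finite expression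
in coefficients of Z and earlier ones of Z⁻¹, divided by z₀. -/
theorem smooth_inverse {Z Zi : Param → Op} (hZ : ∀ p, OrderLE (Z p) 0)
    (hZi : ∀ p, OrderLE (Zi p) 0) (h0 : ∀ p n, (Z p).1 0 n ≠ 0)
    (hs : ∀ k n, Smooth fun p => (Z p).1 k n) (h : ∀ p, Z p * Zi p = 1) (k n : ℤ) :
    Smooth fun p => (Zi p).1 k n := by
  have key : ∀ (k : ℕ) (n : ℤ), Smooth fun p => (Zi p).1 (-(k : ℤ)) n := by
    intro k
    induction k using Nat.strong_induction_on with
    | _ k ih =>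
      intro n
      have h1 : (fun p => (Zi p).1 (-(k : ℤ)) n) = fun p => ((1 : Op).1 (-(k : ℤ)) n -
          ∑ j ∈ Finset.Ico (-(k : ℤ)) 0, (Z p).1 j n *
            ∑ i ∈ Finset.range (k + j + 1).toNat, ((Ring.choose j i : ℤ) : ℂ) *
              diff^[i] ((Zi p).1 (-(k : ℤ) - j + i)) (n + j - i)) * ((Z p).1 0 n)⁻¹ := by
        funext p
        rw [eq_mul_inv_iff_mul_eq₀ (h0 p n), ← h p,
          mul_coeff_eq_sum (hZ p) (hZi p) (-(k : ℤ)) n (J := -(k : ℤ)) (by omega),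
          ← Finset.Ico_insert_right (show -(k : ℤ) ≤ 0 by omega), Finset.sum_insert (by simp),
          leftShift_zero]
        have h2 : ∀ j ∈ Finset.Ico (-(k : ℤ)) 0, (Z p).1 j n * leftShift j (Zi p).1 (-(k : ℤ)) n
            = (Z p).1 j n * ∑ i ∈ Finset.range (k + j + 1).toNat, ((Ring.choose j i : ℤ) : ℂ) *
              diff^[i] ((Zi p).1 (-(k : ℤ) - j + i)) (n + j - i) := by
          intro j hj
          rw [Finset.mem_Ico] at hj
          rw [leftShift_eq_sum (hZi p) j (-(k : ℤ)) n (K := (k + j + 1).toNat) (by omega)]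
        rw [Finset.sum_congr rfl h2]
        ring
      rw [h1]
      refine ((smooth_const _).sub (Smooth.sum fun j hj => (hs j n).mul
        (Smooth.sum fun i hi => (smooth_const _).mul (smooth_iterate_diff (fun m => ?_) i _)))).mul
          ((hs 0 n).inv fun p => h0 p n)
      rw [Finset.mem_Ico] at hj
      rw [Finset.mem_range] at hi
      obtain ⟨r, hr⟩ : ∃ r : ℕ, -(k : ℤ) - j + i = -(r : ℤ) := ⟨(k + j - i).toNat, by omega⟩
      rw [hr]
      exact ih r (by omega) m
  rcases lt_or_ge 0 k with hk | hk
  · have : (fun p => (Zi p).1 k n) = fun _ => 0 := funext fun p => by rw [hZi p k hk]; rfl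
    rw [this]
    exact smooth_const 0
  · obtain ⟨r, rfl⟩ : ∃ r : ℕ, k = -(r : ℤ) := ⟨(-k).toNat, by omega⟩
    exact key r n

/-! ### From the stated hierarchy to the rings of smooth families -/

section Bridge

variable {Z Zi : Param → Op}

theorem IsDressing.orderLE_inv (hZ : IsDressing Z Zi) (p : Param) : OrderLE (Zi p) 0 :=
  orderLE_zero_of_mul_eq_one (hZ.order_le p) (hZ.lead_ne p) (hZ.mul_inv p)

/-- The dressing operator as an element of the ring of families. -/
def IsDressing.fam (hZ : IsDressing Z Zi) : OpFam := ⟨Z, ⟨0, hZ.order_le⟩, hZ.smooth⟩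

/-- The inverse of the dressing operator as an element of the ring of families. -/
def IsDressing.famInv (hZ : IsDressing Z Zi) : OpFam :=
  ⟨Zi, ⟨0, hZ.orderLE_inv⟩,
    smooth_inverse hZ.order_le hZ.orderLE_inv hZ.lead_ne hZ.smooth hZ.mul_inv⟩

/-- The Lax operator as an element of the ring of families. -/
def IsDressing.laxFam (hZ : IsDressing Z Zi) : OpFam := hZ.fam * DFam * hZ.famInv

theorem IsDressing.laxFam_pow_apply (hZ : IsDressing Z Zi) (l : ℕ) (p : Param) :
    (hZ.laxFam ^ l).1 p = pow (lax Z Zi p) l := by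
  rw [pow_eq]; rfl

theorem IsDressing.isSato (hZ : IsDressing Z Zi) : IsSato hZ.fam hZ.famInv where
  ord := ordLE_iff.2 hZ.order_le
  ord_inv := ordLE_iff.2 hZ.orderLE_inv
  isUnit_lead := isUnit_fn hZ.lead_ne
  mul_inv := Subtype.ext (funext hZ.mul_inv)
  inv_mul := Subtype.ext (funext hZ.inv_mul)
  sato l := derivOp_eq fun p => by
    have h := hZ.sato l.succPNat p
    rw [Nat.succPNat_coe, ← hZ.laxFam_pow_apply] at h
    exact h

theorem IsDressing.coeff_posSeries_apply (hZ : IsDressing Z Zi) (l : ℕ) (p : Param) :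
    (coeff (l + 1) (posSeries hZ.laxFam)).1 p
      = geOne (pow (lax Z Zi p) (l.succPNat : ℕ)) := by
  rw [posSeries, coeff_mk, if_neg (Nat.succ_ne_zero l), Nat.succPNat_coe, ← hZ.laxFam_pow_apply]
  rfl

theorem coeff_zero_posSeries (L : OpFam) : coeff 0 (posSeries L) = 0 := by
  rw [posSeries, coeff_mk, if_pos rfl]

theorem IsDressing.isSquaredEigen (hZ : IsDressing Z Zi) {φ ψ S : Param → ℤ → ℂ}
    (hφ : IsEigenfunction (lax Z Zi) φ) (hψ : IsAdjointEigenfunction (lax Z Zi) ψ)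
    (hS : IsPotential (lax Z Zi) φ ψ S) :
    IsSquaredEigen hZ.laxFam ⟨φ, hφ.smooth⟩ ⟨ψ, hψ.smooth⟩ ⟨S, hS.smooth⟩ where
  eigen k := by
    cases k with
    | zero => simp [timeFn_zero, coeff_zero_posSeries]
    | succ l =>
      refine derivFn_eq fun p n => ?_
      have h := hφ.flow l.succPNat p n
      rw [act_eq, ← hZ.coeff_posSeries_apply] at h
      exact h
  adjoint k := by
    cases k with
    | zero => simp [timeFn_zero, coeff_zero_posSeries]
    | succ l =>
      refine derivFn_eq fun p n => ?_
      have h := hψ.flow l.succPNat p n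
      rw [invDiffAdjAct_eq, ← hZ.coeff_posSeries_apply, ← mul_assoc] at h
      exact h
  potential k := by
    cases k with
    | zero => simp [timeFn_zero, coeff_zero_posSeries]
    | succ l =>
      refine derivFn_eq fun p n => ?_
      have h := hS.flow l.succPNat p n
      -- The final factor Δ⁻¹ turns the residue into a coefficient of Δ⁰.
      rw [res, mul_Dinv_coeff, ← hZ.coeff_posSeries_apply] at h
      exact h

end Bridge

theorem IsSato.derivOp_lax {Z Zi : OpFam} (h : IsSato Z Zi) {v : Param} {B : OpFam}
    (hB : derivOp v Z = B * Z) :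
    derivOp v (Z * DFam * Zi) = B * (Z * DFam * Zi) - Z * DFam * Zi * B := by
  have h1 : derivOp v Zi = -(Zi * B) := by
    have h2 : derivOp v (Z * Zi) = 0 := by
      rw [h.mul_inv]
      exact derivOp_const v 1 _
    rw [derivOp_mul, hB, mul_assoc, h.mul_inv, mul_one] at h2
    rw [← one_mul (derivOp v Zi), ← h.inv_mul, mul_assoc, eq_neg_of_add_eq_zero_right h2, mul_neg]
  rw [derivOp_mul, derivOp_mul, hB, derivOp_DFam, h1]
  noncomm_ring

/-! ### Tau functions -/

theorem coeff_zero_mul {R : Type*} [Semiring R] (F G : R⟦X⟧) :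
    coeff 0 (F * G) = coeff 0 F * coeff 0 G := by
  simp

theorem coeff_zero_shiftedAdjoint {Z Zi : OpFam} (h : IsSato Z Zi) (ψ : Fn) :
    coeff 0 (shiftedAdjoint Z ψ) = ψ := by
  have h1 := congrArg (coeff 0) (h.shiftPS_shiftedAdjoint ψ)
  rw [map_sub, coeff_zero_mul, coeff_zero_transitionCoeff, zero_mul, sub_zero, coeff_map,
    coeff_zero_C] at h1
  exact shiftFn.injective h1

/-- Coefficientwise directional derivative of power series. -/
def derivPS (v : Param) (F : Fn⟦X⟧) : Fn⟦X⟧ := PowerSeries.mk fun k => derivFn v (coeff k F)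

theorem coeff_derivPS (v : Param) (F : Fn⟦X⟧) (k : ℕ) :
    coeff k (derivPS v F) = derivFn v (coeff k F) := coeff_mk k fun k => derivFn v (coeff k F)

theorem euler_derivPS (v : Param) (F : Fn⟦X⟧) :
    euler timeFn (derivPS v F) = derivPS v (euler timeFn F) := by
  ext1 k
  simp only [coeff_derivPS, coeff_euler, map_add, map_nsmul, map_sum]
  congr 1
  exact Finset.sum_congr rfl fun x _ => derivFn_comm _ _ _

/-- The evolution of a pair of tau functions under the symmetry flow, up to a term that does not
depend on the times. -/
theorem exists_tau_flow {ι : Type*} [Fintype ι] {Z Zi : OpFam} (h : IsSato Z Zi)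
    {φ ψ S : ι → Fn} (hs : ∀ i, IsSquaredEigen (Z * DFam * Zi) (φ i) (ψ i) (S i))
    (hflow : derivOp aDir Z = (∑ i, fnFam (φ i) * conjFam (ψ i)) * Z)
    {t₀ t₁ : Fn} (ht₀ : IsUnit t₀) (ht₁ : IsUnit t₁)
    (hwave : symbol Z * C t₁ = shiftSeries t₀) :
    ∃ f : Fn, (∀ k, timeFn k f = 0) ∧ derivFn aDir t₀ = (∑ i, S i + f) * t₀ ∧
      derivFn aDir t₁ = (-∑ i, (φ i * ψ i - S i) + f) * t₁ := by
  -- The logarithmic derivative of τ₁ along the flow.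
  set a := derivFn aDir t₁ * Ring.inverse t₁ with ha
  have hat : a * t₁ = derivFn aDir t₁ := by
    rw [ha, mul_assoc, Ring.inverse_mul_cancel _ ht₁, mul_one]
  set G := shiftSeries t₀ with hG
  set H : Fn⟦X⟧ := ∑ i, C (φ i) * shiftedAdjoint Z (ψ i) with hH
  -- On the wave function each Δ⁻¹(Γψ_i)Δ is multiplication by H_i, so the flow multiplies the
  -- symbol of Z by a function series.
  have hsym : symbol (derivOp aDir Z) = H * symbol Z := by
    rw [hflow, Finset.sum_mul, map_sum, hH, Finset.sum_mul]
    refine Finset.sum_congr rfl fun i _ => ?_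
    rw [mul_assoc, symbol_fnFam_mul, ← h.shiftedAdjoint_mul, mul_assoc]
  have hdG : derivPS aDir G = (H + C a) * G := by
    have h1 : derivPS aDir G = symbol (derivOp aDir Z) * C t₁ + symbol Z * C (a * t₁) := by
      rw [← hwave, hat]
      ext1 k
      rw [coeff_derivPS, coeff_mul_C, derivFn_mul, map_add, coeff_mul_C, coeff_mul_C, coeff_symbol,
        coeff_symbol, co_derivOp]
    rw [h1, hsym, ← hwave, map_mul]
    ring
  have hG0 : coeff 0 G = t₀ := coeff_zero_shiftSeries t₀
  have hGu : IsUnit G := by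
    rw [isUnit_iff_constantCoeff, ← coeff_zero_eq_constantCoeff_apply, hG0]
    exact ht₀
  -- E commutes with ∂_α and annihilates the invertible series G = τ₀(t - [z]), hence also its
  -- logarithmic derivative.
  have hE : euler timeFn (H + C a) = 0 := by
    have h1 := congrArg (euler timeFn) hdG
    rw [euler_derivPS, euler_mul timeFn_mul, hG, euler_shiftSeries, mul_zero, add_zero, ← hG] at h1
    have h2 : derivPS aDir 0 = 0 := by
      ext1 k
      rw [coeff_derivPS, map_zero, map_zero]
    rw [h2] at h1
    exact hGu.mul_left_eq_zero.1 h1.symm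
  have hHat : euler timeFn H = euler timeFn (C (∑ i, (φ i * ψ i - S i))) := by
    rw [hH, map_sum, map_sum C, map_sum]
    exact Finset.sum_congr rfl fun i _ => (euler_C_hatS h (hs i)).symm
  -- The choice of f makes the equation for τ₁ a tautology. For τ₀, the coefficient of z⁰ gives ∑
  -- φ_i ψ_i + a, which is ∑ S_i + f.
  refine ⟨∑ i, (φ i * ψ i - S i) + a, fun k => ?_, ?_, ?_⟩
  · rw [map_add, hHat, ← map_add, ← map_add C, euler_timeFn_C] at hE
    have := congrArg (coeff k) hE
    rwa [coeff_mk, map_zero] at this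
  · have h1 := congrArg (coeff 0) hdG
    rw [coeff_derivPS, coeff_zero_mul, hG0, map_add, coeff_zero_C, hH, map_sum] at h1
    simp only [coeff_C_mul, coeff_zero_shiftedAdjoint h] at h1
    rw [h1, Finset.sum_sub_distrib]
    ring
  · rw [← hat]
    ring

/-! ### Factors independent of the times and the normalization of a pair -/

theorem shiftCoeff_const_mul (κ : ℝ → ℂ) (ε : ℂ) (f : Param → ℂ) (k : ℕ) :
    shiftCoeff ε (fun p => κ p.2 * f p) k = fun p => κ p.2 * shiftCoeff ε f k p := by
  induction k using Nat.strong_induction_on with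
  | _ k ih =>
    cases k with
    | zero => rw [shiftCoeff, shiftCoeff]
    | succ k =>
      funext p
      rw [shiftCoeff, shiftCoeff]
      simp only
      rw [mul_left_comm, Finset.mul_sum (f := fun l : Fin (k + 1) =>
        lineDeriv ℝ (shiftCoeff ε f (k - l)) p (tDir l.1.succPNat))]
      refine congrArg _ (Finset.sum_congr rfl fun l _ => ?_)
      rw [ih (k - l) (by omega)]
      simp only [lineDeriv, tDir, Prod.snd_add, Prod.smul_snd, smul_zero, add_zero]
      exact deriv_const_mul_field _

theorem IsTauPair.const_mul {Z Zi : Param → Op} {τ₀ τ₁ : ℤ → Param → ℂ}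
    (h : IsTauPair Z Zi τ₀ τ₁) {κ : ℤ → ℝ → ℂ} (hκ : ∀ n, ContDiff ℝ ∞ (κ n))
    (h0 : ∀ n a, κ n a ≠ 0) :
    IsTauPair Z Zi (fun n p => κ n p.2 * τ₀ n p) (fun n p => κ n p.2 * τ₁ n p) where
  smooth₀ n := (smooth_comp_snd (hκ n)).mul (h.smooth₀ n)
  smooth₁ n := (smooth_comp_snd (hκ n)).mul (h.smooth₁ n)
  ne_zero₀ n p := mul_ne_zero (h0 n _) (h.ne_zero₀ n p)
  ne_zero₁ n p := mul_ne_zero (h0 n _) (h.ne_zero₁ n p)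
  wave k n p := by
    rw [h.wave, shiftCoeff_const_mul, mul_div_mul_left _ _ (h0 n _)]
  adjWave k n p := by
    rw [h.adjWave, shiftCoeff_const_mul, mul_div_mul_left _ _ (h0 n _)]

/-- Take exp(-∫₀ᵃ c), which is smooth and has no zeros. -/
theorem exists_contDiff_hasDerivAt_mul {c : ℝ → ℂ} (hc : ContDiff ℝ ∞ c) :
    ∃ κ : ℝ → ℂ, ContDiff ℝ ∞ κ ∧ (∀ a, κ a ≠ 0) ∧ ∀ a, HasDerivAt κ (-c a * κ a) a := by
  set F : ℝ → ℂ := fun a => ∫ s in (0 : ℝ)..a, c s with hF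
  have hd : ∀ a, HasDerivAt F (c a) a := fun a =>
    intervalIntegral.integral_hasDerivAt_right (hc.continuous.intervalIntegrable _ _)
      (hc.continuous.stronglyMeasurableAtFilter _ _) hc.continuous.continuousAt
  have hFs : ContDiff ℝ ∞ F := by
    rw [contDiff_infty_iff_deriv]
    refine ⟨fun a => (hd a).differentiableAt, ?_⟩
    rwa [show deriv F = c from funext fun a => (hd a).deriv]
  refine ⟨fun a => Complex.exp (-F a), hFs.neg.cexp, fun a => Complex.exp_ne_zero _, fun a => ?_⟩
  have := (hd a).neg.cexp
  rwa [mul_comm] at this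

theorem hasLineDerivAt_comp_snd {κ : ℝ → ℂ} {κ' : ℂ} {p : Param} (h : HasDerivAt κ κ' p.2) :
    HasLineDerivAt ℝ (fun q : Param => κ q.2) κ' p aDir := by
  have h1 : HasDerivAt (fun t : ℝ => p.2 + t) 1 0 := (hasDerivAt_id 0).const_add _
  have h2 := HasDerivAt.scomp (0 : ℝ) (g₁ := κ) (h := fun t : ℝ => p.2 + t) (g₁' := κ')
    (by simpa using h) h1
  simpa [HasLineDerivAt, aDir, Function.comp_def] using h2

theorem exists_time_independent {f : Fn} (hf : ∀ k, timeFn k f = 0) :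
    ∃ c : ℤ → ℝ → ℂ, (∀ n, ContDiff ℝ ∞ (c n)) ∧ ∀ n p, f.1 p n = c n p.2 := by
  refine ⟨fun n a => f.1 (0, a) n, fun n => ?_, fun n p => ?_⟩
  · have := (f.2 n).contDiff_line (0, 0) (0, 1)
    simpa using this
  · refine (f.2 n).eq_of_lineDeriv_tDir_eq_zero (fun i q => ?_) p.1 p.2
    have := congrFun (congrFun (congrArg Subtype.val (hf (i.natPred + 1))) q) n
    have h1 : tDirNat (i.natPred + 1) = tDir i := by
      rw [tDirNat, PNat.succPNat_natPred]
    rw [← h1]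
    exact this

end DMKP

end

/-! ### The theorem -/

theorem theorem4p1 {m : ℕ} (Z Zi : DMKP.Param → DMKP.Op) (φ ψ S : Fin m → DMKP.Param → ℤ → ℂ)
    (hZ : DMKP.IsDressing Z Zi)
    (hφ : ∀ i, DMKP.IsEigenfunction (DMKP.lax Z Zi) (φ i))
    (hψ : ∀ i, DMKP.IsAdjointEigenfunction (DMKP.lax Z Zi) (ψ i))
    (hS : ∀ i, DMKP.IsPotential (DMKP.lax Z Zi) (φ i) (ψ i) (S i))
    (hflow : DMKP.IsSymmetryFlow Z φ ψ) :
    -- the flow on the Lax operator is `∂_α L = [∑ φ_i Δ⁻¹ (Γψ_i) Δ, L]`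
    (∀ p, DMKP.HasOpDeriv (DMKP.lax Z Zi)
      (DMKP.symOp φ ψ p * DMKP.lax Z Zi p - DMKP.lax Z Zi p * DMKP.symOp φ ψ p) p DMKP.aDir) ∧
    ∀ τ₀ τ₁ : ℤ → DMKP.Param → ℂ, DMKP.IsTauPair Z Zi τ₀ τ₁ →
      -- any pair of tau functions, up to one common term independent of the times
      (∃ c : ℤ → ℝ → ℂ, ∀ n p,
        HasLineDerivAt ℝ (τ₀ n) (((∑ i, S i p n) + c n p.2) * τ₀ n p) p DMKP.aDir ∧
        HasLineDerivAt ℝ (τ₁ n)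
          ((-(∑ i, DMKP.hatS (φ i) (ψ i) (S i) p n) + c n p.2) * τ₁ n p) p DMKP.aDir) ∧
      -- the pair normalized by one common nonzero factor independent of the times
      ∃ κ : ℤ → ℝ → ℂ, (∀ n a, κ n a ≠ 0) ∧
        DMKP.IsTauPair Z Zi (fun n p => κ n p.2 * τ₀ n p) (fun n p => κ n p.2 * τ₁ n p) ∧
        ∀ n p,
          HasLineDerivAt ℝ (fun q => κ n q.2 * τ₀ n q)
            ((∑ i, S i p n) * (κ n p.2 * τ₀ n p)) p DMKP.aDir ∧
          HasLineDerivAt ℝ (fun q => κ n q.2 * τ₁ n q)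
            ((-(∑ i, DMKP.hatS (φ i) (ψ i) (S i) p n)) * (κ n p.2 * τ₁ n p)) p DMKP.aDir := by

  have hs := fun i => hZ.isSquaredEigen (hφ i) (hψ i) (hS i)
  have hsym : ∀ p, DMKP.symOp φ ψ p = (∑ i, DMKP.fnFam ⟨φ i, (hφ i).smooth⟩ *
      DMKP.conjFam ⟨ψ i, (hψ i).smooth⟩).1 p := by
    intro p
    simp only [DMKP.symOp, AddSubmonoidClass.coe_finsetSum, Finset.sum_apply]
    refine Finset.sum_congr rfl fun i _ => ?_
    rw [mul_assoc, mul_assoc, ← mul_assoc DMKP.Dinv]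
    rfl
  have hfl : DMKP.derivOp DMKP.aDir hZ.fam = (∑ i, DMKP.fnFam ⟨φ i, (hφ i).smooth⟩ *
      DMKP.conjFam ⟨ψ i, (hψ i).smooth⟩) * hZ.fam := DMKP.derivOp_eq fun p => by
    have h := hflow p
    rw [hsym] at h
    exact h
  refine ⟨fun p => ?_, fun τ₀ τ₁ hτ => ?_⟩
  · rw [hsym]
    have h := DMKP.hasOpDeriv_derivOp DMKP.aDir hZ.laxFam p
    rw [DMKP.IsDressing.laxFam, hZ.isSato.derivOp_lax hfl] at h
    exact h
  · have hwave : DMKP.symbol hZ.fam * PowerSeries.C ⟨fun p n => τ₁ n p, hτ.smooth₁⟩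
        = DMKP.shiftSeries ⟨fun p n => τ₀ n p, hτ.smooth₀⟩ := by
      ext1 k
      refine DMKP.fn_ext fun p n => ?_
      rw [PowerSeries.coeff_mul_C, DMKP.coeff_symbol, DMKP.coeff_shiftSeries_apply]
      exact (eq_div_iff (hτ.ne_zero₁ n p)).1 (hτ.wave k n p)
    obtain ⟨f, hf, h₀, h₁⟩ := DMKP.exists_tau_flow hZ.isSato hs hfl
      (DMKP.isUnit_fn fun p n => hτ.ne_zero₀ n p) (DMKP.isUnit_fn fun p n => hτ.ne_zero₁ n p) hwave
    obtain ⟨c, hc, hfc⟩ := DMKP.exists_time_independent hf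
    have hd₀ : ∀ n p, HasLineDerivAt ℝ (τ₀ n) (((∑ i, S i p n) + c n p.2) * τ₀ n p) p
        DMKP.aDir := by
      intro n p
      have h := DMKP.hasLineDerivAt_derivFn DMKP.aDir ⟨fun p n => τ₀ n p, hτ.smooth₀⟩ p n
      rw [h₀] at h
      convert h using 1
      simp [hfc]
    have hd₁ : ∀ n p, HasLineDerivAt ℝ (τ₁ n)
        ((-(∑ i, DMKP.hatS (φ i) (ψ i) (S i) p n) + c n p.2) * τ₁ n p) p DMKP.aDir := by
      intro n p
      have h := DMKP.hasLineDerivAt_derivFn DMKP.aDir ⟨fun p n => τ₁ n p, hτ.smooth₁⟩ p n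
      rw [h₁] at h
      convert h using 1
      simp [hfc, DMKP.hatS]
    refine ⟨⟨c, fun n p => ⟨hd₀ n p, hd₁ n p⟩⟩, ?_⟩
    -- At each n, ∂_α κ = -cκ cancels the common term c in both equations.
    choose κ hκs hκ0 hκd using fun n => DMKP.exists_contDiff_hasDerivAt_mul (hc n)
    refine ⟨κ, hκ0, hτ.const_mul hκs hκ0, fun n p => ⟨?_, ?_⟩⟩
    · convert DMKP.hasLineDerivAt_mul (DMKP.hasLineDerivAt_comp_snd (hκd n p.2)) (hd₀ n p) using 1
      ring
    · convert DMKP.hasLineDerivAt_mul (DMKP.hasLineDerivAt_comp_snd (hκd n p.2)) (hd₁ n p) using 1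
      ring
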